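/- **Setting.** Let $N\ge 2$ be an integer, let $0=r_1<r_2<\dots<r_{N+1}=1$, let $\epsilon_0,\mu_0>0$, and let $\Gamma=\{x\in\mathbb R^2: |x|<1\}$. For $\epsilon_1,\dots,\epsilon_N,\mu_1,\dots,\mu_N$ with $\tfrac{\epsilon_0}{2}\le\epsilon_l\le 2\epsilon_0$ and $\tfrac{\mu_0}{2}\le\mu_l\le 2\mu_0$, let $\epsilon,\mu$ be the radial step functions on $\Gamma$ equal to $\epsilon_l$, resp. $\mu_l$, for $r_l<|x|<r_{l+1}$, and put $\delta_{\epsilon,\mu}=\|\epsilon_0-\epsilon\|_{L^\infty(\Gamma)}+\|\mu_0-\mu\|_{L^\infty(\Gamma)}$. Let $J_m,Y_m$ be the Bessel functions of the first and second kind of order $m\in\mathbb N_0$, and for fixed $z>0$ write $J_{ml}=J_m(zr_l)$, $J'_{ml}=J_m'(zr_l)$, $Y_{ml}=Y_m(zr_l)$, $Y'_{ml}=Y_m'(zr_l)$. Let $\underline A^{\mathrm{Dir}}_N(z)$ be the matrix of size $(2N-1)\times(2N-1)$ for which $\underline A^{\mathrm{Dir}}_N(z)\,(a_1,a_2,b_2,\dots,a_N,b_N)^\top$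 has, with the convention $b_1=0$, the entries $$a_lJ_{m(l+1)}+b_lY_{m(l+1)}-a_{l+1}J_{m(l+1)}-b_{l+1}Y_{m(l+1)},$$ $$\frac{\epsilon_l}{\epsilon_{l+1}}\big(a_lJ'_{m(l+1)}+b_lY'_{m(l+1)}\big)-a_{l+1}J'_{m(l+1)}-b_{l+1}Y'_{m(l+1)}$$ in rows $2l-1$ and $2l$ respectively, $l=1,\dots,N-1$, and $a_NJ_{m(N+1)}+b_NY_{m(N+1)}$ in the last row. Let $\underline A^{\mathrm{Neu}}_N(z)$ be the matrix obtained by replacing $\epsilon_l$ by $\mu_l$ and the last row by $a_NJ'_{m(N+1)}+b_NY'_{m(N+1)}$. Let $\underline B^{\mathrm{Dir}}_N(z)$ and $\underline B^{\mathrm{Neu}}_N(z)$ be obtained from $\underline A^{\mathrm{Dir}}_N(z)$ and $\underline A^{\mathrm{Neu}}_N(z)$ by replacing $J_{m2},J'_{m2}$ by $Y_{m2},Y'_{m2}$ in the first column. Let $p=r_2/r_{N+1}$. **Claim.** There is a constant $C>0$, depending only on $N$, $(r_l)_l$, $\epsilon_0$ and $\mu_0$, such that for all $\epsilon_l,\mu_l$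 as above there are continuous functions $f^{\mathrm{Dir}}_m,f^{\mathrm{Neu}}_m:(0,\infty)\to\mathbb R$, $m\in\mathbb N_0$, with $$\prod_{l=2}^{N}\Big(\frac{\pi z r_l}{2}\Big)\det\underline A^{\mathrm{Dir}}_N(z)=J_m(zr_{N+1})+f_m^{\mathrm{Dir}}(z),$$ $$|f_m^{\mathrm{Dir}}(z)|\le C\,\delta_{\epsilon,\mu}\max\{|J_m(z)|,|Y_m(z)|\},$$ $$|z^{N}J_m(zq)J_m'(zq)\det\underline B^{\mathrm{Dir}}_N(z)|\le C\max\{|J_m(z)|,|Y_m(z)|\},$$ and $$\prod_{l=2}^{N}\Big(\frac{\pi z r_l}{2}\Big)\det\underline A^{\mathrm{Neu}}_N(z)=J'_m(zr_{N+1})+f_m^{\mathrm{Neu}}(z),$$ $$|f_m^{\mathrm{Neu}}(z)|\le C\,\delta_{\epsilon,\mu}\max\{|J'_m(z)|,|Y'_m(z)|\},$$ $$|z^{N}J_m(zq)J_m'(zq)\det\underline B^{\mathrm{Neu}}_N(z)|\le C\max\{|J'_m(z)|,|Y'_m(z)|\}$$ for all $q\in[pr_2,r_2]$, all $z>0$ and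 all $m\in\mathbb N_0$. -/

import Mathlib

noncomputable section

/-- The Bessel function of the first kind `J_m` of integer order `m ≥ 0`,
`J_m(x) = ∑_k (-1)^k / (k! (m+k)!) (x/2)^(2k+m)`. -/
def besselJ (m : ℕ) (x : ℝ) : ℝ :=
  ∑' k : ℕ, (-1 : ℝ) ^ k / ((Nat.factorial k : ℝ) * (Nat.factorial (m + k) : ℝ)) *
    (x / 2) ^ (2 * k + m)

/-- The Bessel function of the second kind `Y_m` of integer order `m ≥ 0`, for `x > 0`
(Neumann's expansion, with `ψ(k+1) = H_k - γ` inserted):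
`Y_m(x) = (2/π) (log(x/2) + γ) J_m(x) - (1/π) ∑_{k<m} ((m-k-1)!/k!) (x/2)^(2k-m)
  - (1/π) ∑_k (-1)^k (H_k + H_{m+k}) / (k! (m+k)!) (x/2)^(2k+m)`. -/
def besselY (m : ℕ) (x : ℝ) : ℝ :=
  2 / Real.pi * (Real.log (x / 2) + Real.eulerMascheroniConstant) * besselJ m x
    - 1 / Real.pi * ∑ k ∈ Finset.range m,
        (Nat.factorial (m - k - 1) : ℝ) / (Nat.factorial k : ℝ) *
          (x / 2) ^ (2 * (k : ℤ) - (m : ℤ))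
    - 1 / Real.pi * ∑' k : ℕ,
        (-1 : ℝ) ^ k * ((harmonic k : ℝ) + (harmonic (m + k) : ℝ)) /
          ((Nat.factorial k : ℝ) * (Nat.factorial (m + k) : ℝ)) * (x / 2) ^ (2 * k + m)

/-- The radial step profile with value `σ l` on `(r l, r (l+1))` for `l = 1, …, N`
(its values on the finitely many interfaces are irrelevant). -/
def stepProfile (N : ℕ) (r σ : ℕ → ℝ) (t : ℝ) : ℝ :=
  ∑ l ∈ Finset.Icc 1 N, (Set.Ioo (r l) (r (l + 1))).indicator (fun _ => σ l) t

/-- The cross section: the open unit disk of the Euclidean plane. -/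
def crossSection : Set (EuclideanSpace ℝ (Fin 2)) := Metric.ball 0 1

/-- `‖σ₀ - σ‖_{L^∞(Γ)}` for the radial step function `σ` on the unit disk `Γ`. -/
def stepDeviation (N : ℕ) (r : ℕ → ℝ) (σ₀ : ℝ) (σ : ℕ → ℝ) : ℝ :=
  (MeasureTheory.eLpNorm
    (fun x : EuclideanSpace ℝ (Fin 2) => σ₀ - stepProfile N r σ ‖x‖) ⊤
    (MeasureTheory.volume.restrict crossSection)).toReal

/-- `δ_{ε,μ} = ‖ε₀ - ε‖_{L^∞(Γ)} + ‖μ₀ - μ‖_{L^∞(Γ)}`. -/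
def materialDeviation (N : ℕ) (r : ℕ → ℝ) (ε₀ μ₀ : ℝ) (ε μ : ℕ → ℝ) : ℝ :=
  stepDeviation N r ε₀ ε + stepDeviation N r μ₀ μ

/-- The layer `1, …, N` to which the (zero-based) column `j` belongs: the columns are ordered as
`a_1, a_2, b_2, a_3, b_3, …, a_N, b_N`. -/
def columnLayer (j : ℕ) : ℕ := (j + 1) / 2 + 1

/-- The radial function multiplying the coefficient of column `j`: `J_m` for the coefficients `a_l`,
`Y_m` for the coefficients `b_l`, `l ≥ 2`, and `first` for the first column. -/
def columnFun (m : ℕ) (first : ℝ → ℝ) (j : ℕ) : ℝ → ℝ :=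
  if j = 0 then first else if j % 2 = 1 then besselJ m else besselY m

/-- The common shape of the transmission matrices. Rows `2(l-1)` and `2(l-1)+1` (zero-based),
`l = 1, …, N-1`, contain the two transmission conditions between the layers `l` and `l+1` at the
radius `r (l+1)`; the last row contains the boundary condition at `r (N+1)`, the operator
`bc` being the identity (Dirichlet) or the derivative (Neumann). -/
def transmissionMatrix (m N : ℕ) (r σ : ℕ → ℝ) (first : ℝ → ℝ) (bc : (ℝ → ℝ) → ℝ → ℝ) (z : ℝ) :
    Matrix (Fin (2 * N - 1)) (Fin (2 * N - 1)) ℝ :=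
  Matrix.of fun i j =>
    let l : ℕ := (i : ℕ) / 2 + 1
    let φ : ℝ → ℝ := columnFun m first j
    if (i : ℕ) = 2 * N - 2 then
      if columnLayer j = N then bc φ (z * r (N + 1)) else 0
    else if (i : ℕ) % 2 = 0 then
      if columnLayer j = l then φ (z * r (l + 1))
      else if columnLayer j = l + 1 then -φ (z * r (l + 1))
      else 0
    else
      if columnLayer j = l then σ l / σ (l + 1) * deriv φ (z * r (l + 1))
      else if columnLayer j = l + 1 then -deriv φ (z * r (l + 1))
      else 0

/-- The Dirichlet transmission matrix. -/
def AmatDir (m N : ℕ) (r ε : ℕ → ℝ) (z : ℝ) : Matrix (Fin (2 * N - 1)) (Fin (2 * N - 1)) ℝ :=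
  transmissionMatrix m N r ε (besselJ m) id z

/-- The Neumann transmission matrix. -/
def AmatNeu (m N : ℕ) (r μ : ℕ → ℝ) (z : ℝ) : Matrix (Fin (2 * N - 1)) (Fin (2 * N - 1)) ℝ :=
  transmissionMatrix m N r μ (besselJ m) deriv z

/-- The auxiliary Dirichlet matrix: `J_m` is replaced by `Y_m` in the first column. -/
def BmatDir (m N : ℕ) (r ε : ℕ → ℝ) (z : ℝ) : Matrix (Fin (2 * N - 1)) (Fin (2 * N - 1)) ℝ :=
  transmissionMatrix m N r ε (besselY m) id z

/-- The auxiliary Neumann matrix: `J_m` is replaced by `Y_m` in the first column. -/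
def BmatNeu (m N : ℕ) (r μ : ℕ → ℝ) (z : ℝ) : Matrix (Fin (2 * N - 1)) (Fin (2 * N - 1)) ℝ :=
  transmissionMatrix m N r μ (besselY m) deriv z

end

noncomputable section

section

open scoped Nat

/-! ### Power series dominated by the exponential series -/

/-! Determinant. Prescribe the solution in the first layer (`J_m` for A, `Y_m` for B) and continue
it through the interfaces. The resulting coefficient vector has first entry 1 and satisfies every
row except the last, so by Cramer's rule the determinant is the boundary value times a block
triangular minor. The 2×2 blocks of that minor are Wronskians, equal to 2/(π z r_l), and the
prefactor cancels them. What remains is a_N bc(J_m) + b_N bc(Y_m)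
(`prod_mul_det_transmissionMatrix`).

Transfer. Crossing the interface at x = z r changes (a, b) by (s - 1)(π/2)(a xJ' + b xY')(-Y, J),
where s is the ratio of the parameters and s - 1 = O(δ). The estimates thus reduce to bounds,
uniform in m and x, for x times a product of J or Y with J' or Y'. Left of the turning point x = m
the product xYY' is not uniformly bounded, but the smallness of xJJ' compensates.
`exists_bessel_weight` supplies a nondecreasing E ≤ 1 with xJJ' = O(E), xJY' and xYJ' = O(1), xYY' =
O(1/E). The conditions |a| ≤ Q and |b| ≤ Q E then survive each interface with a larger Q, because E
grows outwards. For A one starts from (1, 0); for B from (0, 1), which costs 1/E(z r_2), and this is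
repaid by zq J_m(zq) J_m'(zq) = O(E(zq)) since q ≤ r_2.

Weight. For m ≥ 1 and x ≥ m take E = 1: an adiabatic invariant of Bessel's equation carries a bound
at infinity, uniform in m, back to the turning point, with a frozen frequency in the transition
window of width of order m^(1/3). For x ≤ m, replace Y by z = Y - cJ with z z' ≤ 0. Then J²
increases, z² decreases, the two terms of the Wronskian do not cancel, and E = |J| / max(|J|, |z|)
works. For m = 0 take E = min(1, x). -/

lemma summable_mul_pow_of_abs_le {a : ℕ → ℝ} {C : ℝ} (ha : ∀ k, |a k| ≤ C / k !) (y : ℝ) :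
    Summable fun k => a k * y ^ k := by
  refine Summable.of_norm_bounded (g := fun k => C * (|y| ^ k / k !))
    ((Real.summable_pow_div_factorial |y|).mul_left C) fun k => ?_
  rw [Real.norm_eq_abs, abs_mul, abs_pow]
  calc |a k| * |y| ^ k ≤ C / k ! * |y| ^ k := by gcongr; exact ha k
    _ = C * (|y| ^ k / k !) := by ring

lemma hasDerivAt_tsum_mul_pow {a : ℕ → ℝ} {C : ℝ} (ha : ∀ k, |a k| ≤ C / k !) (y : ℝ) :
    HasDerivAt (fun z => ∑' k, a k * z ^ k) (∑' k : ℕ, ((k : ℝ) + 1) * a (k + 1) * y ^ k) y := by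
  set R := |y| + 1 with hR
  have hR0 : 0 ≤ R := by positivity
  have key : ∀ z ∈ Metric.ball (0 : ℝ) R, ∀ k : ℕ,
      ‖a k * (k * z ^ (k - 1))‖ ≤ C / k ! * (k * R ^ (k - 1)) := by
    intro z hz k
    have hz' : |z| ≤ R := by simpa using (Metric.mem_ball.1 hz).le
    rw [Real.norm_eq_abs, abs_mul, abs_mul, abs_pow, Nat.abs_cast]
    gcongr
    · exact (abs_nonneg _).trans (ha k)
    · exact ha k
  have hu : Summable fun k : ℕ => C / k ! * (k * R ^ (k - 1)) := by
    rw [← summable_nat_add_iff 1]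
    refine ((Real.summable_pow_div_factorial R).mul_left C).congr fun k => ?_
    rw [Nat.factorial_succ]
    push_cast
    field_simp
  have hy : y ∈ Metric.ball (0 : ℝ) R := by simp [hR]
  have h := hasDerivAt_tsum_of_isPreconnected (g := fun k z => a k * z ^ k)
    (g' := fun k z => a k * (k * z ^ (k - 1))) hu
    Metric.isOpen_ball (convex_ball (0 : ℝ) R).isPreconnected
    (fun k z _ => (hasDerivAt_pow k z).const_mul (a k)) (fun k z hz => key z hz k) hy
    (summable_mul_pow_of_abs_le ha y) hy
  convert! h using 1
  have hs : Summable fun k : ℕ => a k * (k * y ^ (k - 1)) :=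
    Summable.of_norm_bounded hu fun k => key y hy k
  rw [hs.tsum_eq_zero_add]
  simp only [Nat.cast_zero, zero_mul, mul_zero, zero_add, Nat.add_sub_cancel]
  exact tsum_congr fun k => by push_cast; ring

/-! ### The series of the Bessel functions -/

/-- Coefficients of the entire function `Φ_m` with `J_m(x) = (x/2)^m Φ_m(x²/4)`. -/
def besselCoeffJ (m k : ℕ) : ℝ := (-1 : ℝ) ^ k / (k ! * (m + k)!)

/-- Coefficients of the entire part of the Bessel function of the second kind. -/
def besselCoeffY (m k : ℕ) : ℝ :=
  (-1 : ℝ) ^ k * ((harmonic k : ℝ) + (harmonic (m + k) : ℝ)) / (k ! * (m + k)!)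

/-- `J_m(x) = (x/2)^m Φ_m(x²/4)`. -/
def besselPhi (m : ℕ) (y : ℝ) : ℝ := ∑' k, besselCoeffJ m k * y ^ k

/-- The entire function in the last term of Neumann's expansion of `Y_m`. -/
def besselPsi (m : ℕ) (y : ℝ) : ℝ := ∑' k, besselCoeffY m k * y ^ k

lemma abs_besselCoeffJ_le (m k : ℕ) : |besselCoeffJ m k| ≤ 1 / k ! := by
  have h1 : (1 : ℝ) ≤ (m + k)! := by exact_mod_cast Nat.one_le_iff_ne_zero.2 (Nat.factorial_ne_zero _)
  have h2 : (0 : ℝ) < k ! := by exact_mod_cast Nat.factorial_pos k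
  rw [besselCoeffJ, abs_div, abs_pow, abs_neg, abs_one, one_pow, abs_of_pos (by positivity)]
  gcongr
  nlinarith

lemma harmonic_nonneg_real (k : ℕ) : (0 : ℝ) ≤ (harmonic k : ℝ) := by
  have : (0 : ℚ) ≤ harmonic k := Finset.sum_nonneg fun i _ => by positivity
  exact_mod_cast this

lemma harmonic_succ_real (k : ℕ) : (harmonic (k + 1) : ℝ) = harmonic k + 1 / ((k : ℝ) + 1) := by
  rw [harmonic_succ]; push_cast; rw [one_div]

/-- Crude but sufficient: H_k + H_{m+k} ≤ 2 (m+k)!, so the harmonic numerators are absorbed by one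
factorial of the denominator, uniformly in m. -/
lemma harmonic_le_factorial (k : ℕ) : (harmonic k : ℝ) ≤ k ! := by
  induction k with
  | zero => simp
  | succ k ih =>
    rw [harmonic_succ_real, Nat.factorial_succ]
    push_cast
    rcases Nat.eq_zero_or_pos k with rfl | hk
    · simp
    have h1 : (1 : ℝ) ≤ k ! := by exact_mod_cast Nat.one_le_iff_ne_zero.2 (Nat.factorial_ne_zero _)
    have h2 : (1 : ℝ) ≤ k := by exact_mod_cast hk
    have h3 : 1 / ((k : ℝ) + 1) ≤ 1 := by rw [div_le_one (by positivity)]; linarith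
    nlinarith

lemma abs_besselCoeffY_le (m k : ℕ) : |besselCoeffY m k| ≤ 2 / k ! := by
  have h1 : (1 : ℝ) ≤ (m + k)! := by exact_mod_cast Nat.one_le_iff_ne_zero.2 (Nat.factorial_ne_zero _)
  have h2 : (0 : ℝ) < k ! := by exact_mod_cast Nat.factorial_pos k
  have h3 := harmonic_nonneg_real k
  have h4 := harmonic_nonneg_real (m + k)
  have h5 := harmonic_le_factorial k
  have h6 := harmonic_le_factorial (m + k)
  have h7 : (k ! : ℝ) ≤ (m + k)! := by exact_mod_cast Nat.factorial_le (Nat.le_add_left _ _)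
  rw [besselCoeffY, abs_div, abs_mul, abs_pow, abs_neg, abs_one, one_pow, one_mul,
    abs_of_pos (by positivity : (0 : ℝ) < k ! * (m + k)!), abs_of_nonneg (by positivity),
    div_le_div_iff₀ (by positivity) h2]
  nlinarith

lemma summable_besselPhi (m : ℕ) (y : ℝ) : Summable fun k => besselCoeffJ m k * y ^ k :=
  summable_mul_pow_of_abs_le (abs_besselCoeffJ_le m) y

lemma summable_besselPsi (m : ℕ) (y : ℝ) : Summable fun k => besselCoeffY m k * y ^ k :=
  summable_mul_pow_of_abs_le (abs_besselCoeffY_le m) y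

lemma hasDerivAt_besselPhi (m : ℕ) (y : ℝ) :
    HasDerivAt (besselPhi m) (-besselPhi (m + 1) y) y := by
  have h := hasDerivAt_tsum_mul_pow (abs_besselCoeffJ_le m) y
  convert! h using 1
  rw [besselPhi, ← tsum_neg]
  refine tsum_congr fun k => ?_
  rw [besselCoeffJ, besselCoeffJ, show m + 1 + k = m + (k + 1) by ring, Nat.factorial_succ k]
  push_cast
  field_simp
  ring

lemma besselPhi_recurrence (m : ℕ) (y : ℝ) :
    besselPhi m y + y * besselPhi (m + 2) y = (m + 1) * besselPhi (m + 1) y := by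
  have h0 := summable_besselPhi m y
  have h1 := summable_besselPhi (m + 1) y
  have h2 := summable_besselPhi (m + 2) y
  rw [besselPhi, besselPhi, besselPhi, h0.tsum_eq_zero_add, h1.tsum_eq_zero_add, mul_add,
    ← tsum_mul_left, ← tsum_mul_left, add_assoc,
    ← ((summable_nat_add_iff 1).2 h0).tsum_add (h2.mul_left y)]
  congr 1
  · simp only [besselCoeffJ, pow_zero, add_zero, Nat.factorial_succ, Nat.factorial_zero]
    push_cast
    field_simp
  · refine tsum_congr fun k => ?_
    simp only [besselCoeffJ]
    rw [show m + 1 + (k + 1) = (m + (k + 1)) + 1 by ring, show m + 2 + k = (m + (k + 1)) + 1 by ring,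
      Nat.factorial_succ (m + (k + 1)), Nat.factorial_succ k]
    push_cast
    field_simp
    ring

/-- The index shift turns H_k into H_{k+1} = H_k + 1/(k+1). The extra terms sum to the series of
`besselPhi m` without its constant term, divided by y. -/
lemma hasDerivAt_besselPsi (m : ℕ) {y : ℝ} (hy : y ≠ 0) :
    HasDerivAt (besselPsi m) (-besselPsi (m + 1) y + (besselPhi m y - 1 / m !) / y) y := by
  have h := hasDerivAt_tsum_mul_pow (abs_besselCoeffY_le m) y
  convert! h using 1
  have h0 := summable_besselPhi m y
  have h0' := (summable_nat_add_iff 1).2 h0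
  have h1 := summable_besselPsi (m + 1) y
  rw [besselPhi, besselPsi, h0.tsum_eq_zero_add, ← tsum_neg]
  rw [show besselCoeffJ m 0 * y ^ 0 = 1 / (m ! : ℝ) by simp [besselCoeffJ], add_sub_cancel_left,
    ← tsum_div_const, ← h1.neg.tsum_add (h0'.div_const y)]
  refine tsum_congr fun k => ?_
  simp only [besselCoeffJ, besselCoeffY]
  rw [show m + 1 + k = m + (k + 1) by ring, Nat.factorial_succ k, harmonic_succ_real k]
  push_cast
  field_simp
  ring

lemma besselPsi_recurrence (m : ℕ) (y : ℝ) :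
    besselPsi m y + y * besselPsi (m + 2) y = (m + 1) * besselPsi (m + 1) y - 1 / (m + 1)! := by
  have h0 := summable_besselPsi m y
  have h1 := summable_besselPsi (m + 1) y
  have h2 := summable_besselPsi (m + 2) y
  rw [besselPsi, besselPsi, besselPsi, h0.tsum_eq_zero_add, h1.tsum_eq_zero_add, mul_add,
    ← tsum_mul_left, ← tsum_mul_left, add_assoc,
    ← ((summable_nat_add_iff 1).2 h0).tsum_add (h2.mul_left y), add_sub_right_comm]
  congr 1
  · simp only [besselCoeffY, pow_zero, add_zero, Nat.factorial_succ, Nat.factorial_zero,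
      harmonic_succ_real]
    push_cast
    simp only [harmonic_zero]
    push_cast
    field_simp
    ring
  · refine tsum_congr fun k => ?_
    simp only [besselCoeffY]
    rw [show m + 1 + (k + 1) = (m + (k + 1)) + 1 by ring, show m + 2 + k = (m + (k + 1)) + 1 by ring,
      Nat.factorial_succ (m + (k + 1)), Nat.factorial_succ k, harmonic_succ_real (m + (k + 1)),
      harmonic_succ_real k]
    push_cast
    field_simp
    ring

/-! ### Derivatives and three-term recurrences of J_m and Y_m -/

lemma besselJ_eq (m : ℕ) (x : ℝ) : besselJ m x = (x / 2) ^ m * besselPhi m ((x / 2) ^ 2) := by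
  rw [besselJ, besselPhi, ← tsum_mul_left]
  refine tsum_congr fun k => ?_
  rw [besselCoeffJ, ← pow_mul, pow_add]
  ring

/-- The singular finite sum in Neumann's expansion of `Y_m`. -/
def besselSing (m : ℕ) (x : ℝ) : ℝ :=
  ∑ k ∈ Finset.range m, ((m - k - 1)! : ℝ) / (k ! : ℝ) * (x / 2) ^ (2 * (k : ℤ) - (m : ℤ))

/-- The entire part of Neumann's expansion of `Y_m`. -/
def besselReg (m : ℕ) (x : ℝ) : ℝ := (x / 2) ^ m * besselPsi m ((x / 2) ^ 2)

lemma besselY_eq (m : ℕ) (x : ℝ) :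
    besselY m x = 2 / Real.pi * (Real.log (x / 2) + Real.eulerMascheroniConstant) * besselJ m x
      - 1 / Real.pi * besselSing m x - 1 / Real.pi * besselReg m x := by
  have h : ∀ k, (-1 : ℝ) ^ k * ((harmonic k : ℝ) + (harmonic (m + k) : ℝ)) /
      ((Nat.factorial k : ℝ) * (Nat.factorial (m + k) : ℝ)) * (x / 2) ^ (2 * k + m)
      = (x / 2) ^ m * (besselCoeffY m k * ((x / 2) ^ 2) ^ k) := fun k => by
    rw [besselCoeffY, ← pow_mul, pow_add]
    ring
  rw [besselY, besselReg, besselSing, besselPsi]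
  simp only [h, tsum_mul_left]

lemma hasDerivAt_besselJ (m : ℕ) {x : ℝ} (hx : x ≠ 0) :
    HasDerivAt (besselJ m) (m / x * besselJ m x - besselJ (m + 1) x) x := by
  have h1 : HasDerivAt (fun x : ℝ => x / 2) (1 / 2) x := (hasDerivAt_id x).div_const 2
  have h := (h1.pow m).mul ((hasDerivAt_besselPhi m ((x / 2) ^ 2)).comp x (h1.pow 2))
  have he : besselJ m = (fun x : ℝ => x / 2) ^ m * (besselPhi m ∘ ((fun x : ℝ => x / 2) ^ 2)) := by
    ext x; simp [besselJ_eq]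
  rw [he]
  convert! h using 1
  rw [← he, besselJ_eq, besselJ_eq]
  rcases m with _ | m
  · simp; ring
  · simp only [Nat.add_sub_cancel, Function.comp, Pi.pow_apply]
    push_cast
    field_simp
    ring

lemma besselJ_recurrence (m : ℕ) {x : ℝ} (hx : x ≠ 0) :
    besselJ m x + besselJ (m + 2) x = 2 * (m + 1) / x * besselJ (m + 1) x := by
  simp only [besselJ_eq]
  have h := besselPhi_recurrence m ((x / 2) ^ 2)
  have : (x / 2) ^ m * besselPhi m ((x / 2) ^ 2) + (x / 2) ^ (m + 2) * besselPhi (m + 2) ((x / 2) ^ 2)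
      = (x / 2) ^ m * ((m + 1) * besselPhi (m + 1) ((x / 2) ^ 2)) := by rw [← h]; ring
  rw [this, pow_succ (x / 2) m, mul_comm 2, mul_div_assoc, ← one_div_div]
  have hx2 : x / 2 ≠ 0 := div_ne_zero hx two_ne_zero
  generalize x / 2 = h at *
  field_simp

/-- `besselReg` and `besselSing` each miss the ladder relation. Their multiples of (x/2)^m / m!
cancel in the sum, and the remaining 2J/x cancels the derivative of the logarithm in Y_m. -/
lemma hasDerivAt_besselReg (m : ℕ) {x : ℝ} (hx : x ≠ 0) :
    HasDerivAt (besselReg m) (m / x * besselReg m x - besselReg (m + 1) x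
      + 2 / x * (besselJ m x - (x / 2) ^ m / m !)) x := by
  have h1 : HasDerivAt (fun x : ℝ => x / 2) (1 / 2) x := (hasDerivAt_id x).div_const 2
  have h := (h1.pow m).mul ((hasDerivAt_besselPsi m
    (pow_ne_zero 2 (div_ne_zero hx two_ne_zero))).comp x (h1.pow 2))
  have he : besselReg m = (fun x : ℝ => x / 2) ^ m * (besselPsi m ∘ ((fun x : ℝ => x / 2) ^ 2)) := by
    ext x; simp [besselReg]
  rw [he]
  convert! h using 1
  rw [← he, besselReg, besselReg, besselJ_eq]
  rcases m with _ | m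
  · simp only [Function.comp, Pi.pow_apply, Nat.cast_zero]
    field_simp
    ring
  · simp only [Nat.add_sub_cancel, Function.comp, Pi.pow_apply]
    push_cast
    field_simp
    ring

lemma hasDerivAt_besselSing (m : ℕ) {x : ℝ} (hx : x ≠ 0) :
    HasDerivAt (besselSing m) (m / x * besselSing m x - besselSing (m + 1) x
      + 2 / x * ((x / 2) ^ m / m !)) x := by
  have hx2 : x / 2 ≠ 0 := div_ne_zero hx two_ne_zero
  have h : HasDerivAt (besselSing m) (∑ k ∈ Finset.range m, ((m - k - 1)! : ℝ) / (k ! : ℝ) *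
      (((2 * (k : ℤ) - (m : ℤ) : ℤ) : ℝ) * (x / 2) ^ (2 * (k : ℤ) - (m : ℤ) - 1) * (1 / 2))) x := by
    unfold besselSing
    refine HasDerivAt.fun_sum fun k _ => HasDerivAt.const_mul _ ?_
    exact (hasDerivAt_zpow (2 * (k : ℤ) - (m : ℤ)) (x / 2) (Or.inl hx2)).comp x
      ((hasDerivAt_id x).div_const 2)
  convert! h using 1
  rw [besselSing, besselSing, Finset.sum_range_succ, Finset.mul_sum]
  have hlast : (((m + 1 - m - 1)! : ℕ) : ℝ) / (m ! : ℝ) * (x / 2) ^ (2 * (m : ℤ) - ((m + 1 : ℕ) : ℤ))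
      = 2 / x * ((x / 2) ^ m / m !) := by
    rw [show 2 * (m : ℤ) - ((m + 1 : ℕ) : ℤ) = (m : ℤ) - 1 by push_cast; ring, zpow_sub_one₀ hx2,
      zpow_natCast]
    simp
    ring
  rw [hlast, sub_add_eq_sub_sub, sub_add_cancel, ← Finset.sum_sub_distrib]
  refine Finset.sum_congr rfl fun k hk => ?_
  have hk' : k < m := Finset.mem_range.1 hk
  obtain ⟨j, rfl⟩ : ∃ j, m = k + 1 + j := ⟨m - (k + 1), by omega⟩
  rw [show k + 1 + j - k - 1 = j by omega, show k + 1 + j + 1 - k - 1 = j + 1 by omega,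
    show 2 * (k : ℤ) - ((k + 1 + j + 1 : ℕ) : ℤ) = 2 * (k : ℤ) - ((k + 1 + j : ℕ) : ℤ) - 1 by
      push_cast; ring, zpow_sub_one₀ hx2, Nat.factorial_succ j]
  push_cast
  field_simp
  ring

lemma besselSing_recurrence (m : ℕ) {x : ℝ} (hx : x ≠ 0) :
    besselSing m x + besselSing (m + 2) x = 2 * (m + 1) / x * besselSing (m + 1) x
      + (x / 2) ^ m / (m + 1)! := by
  have hx2 : x / 2 ≠ 0 := div_ne_zero hx two_ne_zero
  -- The factor k kills the new term k = 0, so the sum takes the range and the exponents of the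
  -- other two.
  have hshift : besselSing m x = ∑ k ∈ Finset.range (m + 1),
      (k : ℝ) * ((m - k)! : ℝ) / (k ! : ℝ) * (x / 2) ^ (2 * (k : ℤ) - (m : ℤ) - 2) := by
    rw [Finset.sum_range_succ', besselSing]
    simp only [Nat.cast_zero, zero_mul, zero_div, add_zero]
    refine Finset.sum_congr rfl fun k hk => ?_
    rw [show m - (k + 1) = m - k - 1 by omega, Nat.factorial_succ k,
      show 2 * ((k + 1 : ℕ) : ℤ) - (m : ℤ) - 2 = 2 * (k : ℤ) - (m : ℤ) by push_cast; ring]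
    push_cast
    field_simp
  rw [hshift, besselSing, besselSing, Finset.sum_range_succ _ (m + 1), ← add_assoc,
    ← Finset.sum_add_distrib, Finset.mul_sum]
  congr 1
  · refine Finset.sum_congr rfl fun k hk => ?_
    have hk' : k < m + 1 := Finset.mem_range.1 hk
    obtain ⟨j, rfl⟩ : ∃ j, m = k + j := ⟨m - k, by omega⟩
    rw [show k + j + 2 - k - 1 = j + 1 by omega, show k + j + 1 - k - 1 = j by omega,
      show k + j - k = j by omega,
      show 2 * (k : ℤ) - ((k + j + 2 : ℕ) : ℤ) = 2 * (k : ℤ) - ((k + j : ℕ) : ℤ) - 2 by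
        push_cast; ring,
      show 2 * (k : ℤ) - ((k + j + 1 : ℕ) : ℤ) = (2 * (k : ℤ) - ((k + j : ℕ) : ℤ) - 2) + 1 by
        push_cast; ring, zpow_add_one₀ hx2, Nat.factorial_succ j]
    push_cast
    field_simp
    ring
  · rw [show 2 * ((m + 1 : ℕ) : ℤ) - ((m + 2 : ℕ) : ℤ) = (m : ℤ) by push_cast; ring, zpow_natCast]
    simp
    ring

lemma besselReg_recurrence (m : ℕ) {x : ℝ} (hx : x ≠ 0) :
    besselReg m x + besselReg (m + 2) x = 2 * (m + 1) / x * besselReg (m + 1) x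
      - (x / 2) ^ m / (m + 1)! := by
  simp only [besselReg]
  have h := besselPsi_recurrence m ((x / 2) ^ 2)
  have : (x / 2) ^ m * besselPsi m ((x / 2) ^ 2) + (x / 2) ^ (m + 2) * besselPsi (m + 2) ((x / 2) ^ 2)
      = (x / 2) ^ m * ((m + 1) * besselPsi (m + 1) ((x / 2) ^ 2) - 1 / (m + 1)!) := by
    rw [← h]; ring
  rw [this, pow_succ (x / 2) m, mul_comm 2, mul_div_assoc, ← one_div_div]
  have hx2 : x / 2 ≠ 0 := div_ne_zero hx two_ne_zero
  generalize x / 2 = h at *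
  field_simp

lemma besselY_recurrence (m : ℕ) {x : ℝ} (hx : x ≠ 0) :
    besselY m x + besselY (m + 2) x = 2 * (m + 1) / x * besselY (m + 1) x := by
  simp only [besselY_eq]
  linear_combination 2 / Real.pi * (Real.log (x / 2) + Real.eulerMascheroniConstant) *
    besselJ_recurrence m hx - 1 / Real.pi * besselSing_recurrence m hx
    - 1 / Real.pi * besselReg_recurrence m hx

lemma hasDerivAt_besselY (m : ℕ) {x : ℝ} (hx : x ≠ 0) :
    HasDerivAt (besselY m) (m / x * besselY m x - besselY (m + 1) x) x := by
  have hlog : HasDerivAt (fun x : ℝ => 2 / Real.pi *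
      (Real.log (x / 2) + Real.eulerMascheroniConstant)) (2 / Real.pi * (1 / x)) x := by
    refine HasDerivAt.const_mul _ (HasDerivAt.add_const _ ?_)
    convert! ((hasDerivAt_id x).div_const 2).log (div_ne_zero hx two_ne_zero) using 1
    simp only [id]
    field_simp
  have h := ((hlog.mul (hasDerivAt_besselJ m hx)).sub
    ((hasDerivAt_besselSing m hx).const_mul (1 / Real.pi))).sub
    ((hasDerivAt_besselReg m hx).const_mul (1 / Real.pi))
  have he : besselY m = ((fun x : ℝ => 2 / Real.pi *
      (Real.log (x / 2) + Real.eulerMascheroniConstant)) * besselJ m -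
      (fun x => 1 / Real.pi * besselSing m x)) - (fun x => 1 / Real.pi * besselReg m x) := by
    ext x; simp [besselY_eq]
  rw [he]
  convert! h using 1
  simp only [Pi.sub_apply, Pi.mul_apply, besselY_eq]
  ring

end

section

open Filter Topology

/-! ### Uniform bounds to the right of the turning point -/

/-- Pairs `(u, x u')` for solutions `u` of Bessel's equation of order `n` on `(0, ∞)`. -/
structure IsBesselPair (n : ℝ) (u v : ℝ → ℝ) : Prop where
  hasDerivAt_fst : ∀ x, 0 < x → HasDerivAt u (v x / x) x
  hasDerivAt_snd : ∀ x, 0 < x → HasDerivAt v (-((x ^ 2 - n ^ 2) / x) * u x) x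

/-- Sequences of functions satisfying the recurrence relations of cylinder functions. -/
structure IsBesselLadder (u : ℕ → ℝ → ℝ) : Prop where
  hasDerivAt : ∀ m x, 0 < x → HasDerivAt (u m) (m / x * u m x - u (m + 1) x) x
  recurrence : ∀ m x, 0 < x → u m x + u (m + 2) x = 2 * (m + 1) / x * u (m + 1) x

/-- The Euler derivative `x u_m'` of a member of a Bessel ladder. -/
def ladderEuler (u : ℕ → ℝ → ℝ) (m : ℕ) (x : ℝ) : ℝ := m * u m x - x * u (m + 1) x

lemma isBesselLadder_besselJ : IsBesselLadder besselJ :=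
  ⟨fun m _ hx => hasDerivAt_besselJ m hx.ne', fun m _ hx => besselJ_recurrence m hx.ne'⟩

lemma isBesselLadder_besselY : IsBesselLadder besselY :=
  ⟨fun m _ hx => hasDerivAt_besselY m hx.ne', fun m _ hx => besselY_recurrence m hx.ne'⟩

lemma IsBesselLadder.hasDerivAt_succ {u : ℕ → ℝ → ℝ} (hu : IsBesselLadder u) (m : ℕ) {x : ℝ}
    (hx : 0 < x) : HasDerivAt (u (m + 1)) (u m x - (m + 1) / x * u (m + 1) x) x := by
  convert! hu.hasDerivAt (m + 1) x hx using 1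
  push_cast
  linear_combination hu.recurrence m x hx

lemma IsBesselLadder.isBesselPair {u : ℕ → ℝ → ℝ} (hu : IsBesselLadder u) (m : ℕ) :
    IsBesselPair m (u m) (ladderEuler u m) := by
  refine ⟨fun x hx => ?_, fun x hx => ?_⟩
  · convert! hu.hasDerivAt m x hx using 1
    rw [ladderEuler]
    field_simp
  · have h := ((hu.hasDerivAt m x hx).const_mul (m : ℝ)).sub
      ((hasDerivAt_id x).mul (hu.hasDerivAt_succ m hx))
    convert! h using 1
    simp only [id]
    field_simp
    ring

/-- The action of a Bessel pair is controlled by its value further to the right. -/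
lemma IsBesselPair.action_le {n a : ℝ} {u v : ℝ → ℝ} (h : IsBesselPair n u v) (ha : 1 ≤ a)
    (hn : n = a ^ 3) {L : ℝ} (hL : ∀ᶠ X in atTop, X * u X ^ 2 + v X ^ 2 / X ≤ L) {x : ℝ}
    (hx0 : 0 < x) (hx : a ^ 6 + 4 * a ^ 4 ≤ x ^ 2) :
    v x ^ 2 / √(x ^ 2 - n ^ 2) + √(x ^ 2 - n ^ 2) * u x ^ 2 ≤ 24 * L := by
  have hn2 : n ^ 2 = a ^ 6 := by rw [hn]; ring
  have ha4 : 1 ≤ a ^ 4 := one_le_pow₀ ha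
  set w : ℝ → ℝ := fun y => √(y ^ 2 - n ^ 2) with hw
  have hsq : ∀ y, x ≤ y → w y ^ 2 = y ^ 2 - n ^ 2 := fun y hy => by
    have : x ^ 2 ≤ y ^ 2 := by gcongr
    exact Real.sq_sqrt (by linarith)
  have hwge : ∀ y, x ≤ y → 2 * a ^ 2 ≤ w y := fun y hy => by
    have : x ^ 2 ≤ y ^ 2 := by gcongr
    refine Real.le_sqrt_of_sq_le ?_
    nlinarith
  have hwpos : ∀ y, x ≤ y → 0 < w y := fun y hy => by
    have := hwge y hy
    have : 0 < a ^ 2 := by positivity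
    linarith
  -- E is the adiabatic invariant at frequency w. Its derivative (y/w)(u² - v²/w²) equals -c (uv)',
  -- so adding c uv leaves only F' = c' uv.
  set E : ℝ → ℝ := fun y => v y ^ 2 / w y + w y * u y ^ 2 with hE
  set c : ℝ → ℝ := fun y => y ^ 2 / w y ^ 3 with hc
  set F : ℝ → ℝ := fun y => E y + c y * (u y * v y) with hF
  have hEuv : ∀ y, x ≤ y → |u y * v y| ≤ E y / 2 := fun y hy => by
    have hp := hwpos y hy
    have e1 : E y - 2 * (u y * v y) = (v y - w y * u y) ^ 2 / w y := by
      simp only [hE]; field_simp; ring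
    have e2 : E y + 2 * (u y * v y) = (v y + w y * u y) ^ 2 / w y := by
      simp only [hE]; field_simp; ring
    have p1 : 0 ≤ (v y - w y * u y) ^ 2 / w y := by positivity
    have p2 : 0 ≤ (v y + w y * u y) ^ 2 / w y := by positivity
    rw [abs_le]
    constructor <;> linarith
  have hc0 : ∀ y, x ≤ y → 0 ≤ c y := fun y hy => by
    have hp := hwpos y hy
    positivity
  -- Here c = (w² + n²)/w³. From w ≥ 2a² ≥ 2 the first part is at most 1/2, and from w³ ≥ 8a⁶ = 8n²
  -- the second is at most 1/8.
  have hcle : ∀ y, x ≤ y → c y ≤ 5 / 8 := fun y hy => by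
    have hp := hwpos y hy
    have hg := hwge y hy
    have hs := hsq y hy
    have ha2 : 1 ≤ a ^ 2 := one_le_pow₀ ha
    simp only [hc]
    rw [div_le_div_iff₀ (by positivity) (by norm_num)]
    have h1 : (2 * a ^ 2) ^ 3 ≤ w y ^ 3 := by gcongr
    have h2 : 2 * w y ^ 2 ≤ w y ^ 3 := by
      have : 2 ≤ w y := by linarith
      nlinarith [sq_nonneg (w y)]
    have h3 : (2 * a ^ 2) ^ 3 = 8 * a ^ 6 := by ring
    nlinarith
  have hFbd : ∀ y, x ≤ y → |c y * (u y * v y)| ≤ 5 / 16 * E y := fun y hy => by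
    rw [abs_mul, abs_of_nonneg (hc0 y hy)]
    calc c y * |u y * v y| ≤ 5 / 8 * (E y / 2) :=
          mul_le_mul (hcle y hy) (hEuv y hy) (abs_nonneg _) (by norm_num)
      _ = _ := by ring
  have hE0 : ∀ y, x ≤ y → 0 ≤ E y := fun y hy => by
    have hp := hwpos y hy
    positivity
  -- Since F' = c' uv with c' ≤ 0 and uv ≤ F, the factor exp(-c) makes G nondecreasing. It stays
  -- between 1/3 and 1, so bounds travel from infinity down to x.
  set G : ℝ → ℝ := fun y => F y * Real.exp (-c y) with hG
  have hwd : ∀ y, x ≤ y → HasDerivAt w (y / w y) y := fun y hy => by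
    have h1 : HasDerivAt (fun y : ℝ => y ^ 2 - n ^ 2) (2 * y) y := by
      simpa using (hasDerivAt_pow 2 y).sub_const (n ^ 2)
    have hp := hwpos y hy
    have := h1.sqrt (by rw [← hsq y hy]; positivity)
    convert! this using 1
    change y / w y = 2 * y / (2 * w y)
    field_simp
  have hcd : ∀ y, x ≤ y → HasDerivAt c (-(y * (y ^ 2 + 2 * n ^ 2) / w y ^ 5)) y := fun y hy => by
    have hp := hwpos y hy
    have := (hasDerivAt_pow 2 y).div ((hwd y hy).pow 3) (by simpa using (pow_pos hp 3).ne')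
    convert! this using 1
    simp only [Pi.pow_apply]
    have hs := hsq y hy
    rw [show n ^ 2 = y ^ 2 - w y ^ 2 by linarith]
    push_cast
    field_simp
    ring
  have hFd : ∀ y, x ≤ y →
      HasDerivAt F (-(y * (y ^ 2 + 2 * n ^ 2) / w y ^ 5) * (u y * v y)) y := fun y hy => by
    have hp := hwpos y hy
    have hy0 : 0 < y := hx0.trans_le hy
    have hu := h.hasDerivAt_fst y hy0
    have hv := h.hasDerivAt_snd y hy0
    have := (((hv.pow 2).div (hwd y hy) hp.ne').add ((hwd y hy).mul (hu.pow 2))).add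
      ((hcd y hy).mul (hu.mul hv))
    convert! this using 1
    simp only [Pi.pow_apply, Pi.mul_apply, hc]
    have hs := hsq y hy
    rw [show n ^ 2 = y ^ 2 - w y ^ 2 by linarith]
    push_cast
    field_simp
    ring
  have hGd : ∀ y, x ≤ y → HasDerivAt G
      ((y * (y ^ 2 + 2 * n ^ 2) / w y ^ 5) * (F y - u y * v y) * Real.exp (-c y)) y :=
    fun y hy => by
      have := (hFd y hy).mul (hcd y hy).neg.exp
      convert! this using 1
      simp only [Pi.neg_apply]
      ring
  have hGmono : MonotoneOn G (Set.Ici x) := by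
    refine monotoneOn_of_deriv_nonneg (convex_Ici x)
      (fun y hy => (hGd y hy).continuousAt.continuousWithinAt)
      (fun y hy => (hGd y (interior_subset hy)).differentiableAt.differentiableWithinAt)
      (fun y hy => ?_)
    have hy' : x ≤ y := interior_subset hy
    rw [(hGd y hy').deriv]
    have hp := hwpos y hy'
    have hy0 : 0 < y := hx0.trans_le hy'
    have h1 := abs_le.1 (hFbd y hy')
    have h2 := abs_le.1 (hEuv y hy')
    have h3 := hE0 y hy'
    have h4 : 0 ≤ F y - u y * v y := by simp only [hF]; linarith
    positivity
  obtain ⟨X, hXL, hXx, hXn⟩ := (hL.and ((eventually_ge_atTop x).and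
    (eventually_ge_atTop (2 * |n|)))).exists
  have hX0 : 0 < X := hx0.trans_le hXx
  have hEX : E X ≤ 2 * L := by
    have hp := hwpos X hXx
    have hs := hsq X hXx
    have hn4 : 4 * n ^ 2 ≤ X ^ 2 := by
      have := abs_nonneg n
      rw [← sq_abs n]
      nlinarith
    have h1 : X / 2 ≤ w X := Real.le_sqrt_of_sq_le (by nlinarith)
    have h2 : w X ≤ X := by
      refine Real.sqrt_le_iff.2 ⟨hX0.le, ?_⟩
      nlinarith [sq_nonneg n]
    have h3 : v X ^ 2 / w X ≤ 2 * (v X ^ 2 / X) := by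
      rw [div_le_iff₀ hp]
      have h5 : 0 ≤ v X ^ 2 / X := by positivity
      have h6 : v X ^ 2 = v X ^ 2 / X * X := by field_simp
      nlinarith
    have h4 : w X * u X ^ 2 ≤ X * u X ^ 2 := by gcongr
    have h5 : 0 ≤ X * u X ^ 2 := by positivity
    simp only [hE]
    linarith
  have hGX : F x * Real.exp (-c x) ≤ F X * Real.exp (-c X) :=
    hGmono (Set.mem_Ici.2 le_rfl) (Set.mem_Ici.2 hXx) hXx
  have h1 := abs_le.1 (hFbd x le_rfl)
  have h2 := abs_le.1 (hFbd X hXx)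
  have h3 := hE0 x le_rfl
  have h4 := hE0 X hXx
  have h5 : F X * Real.exp (-c X) ≤ F X := by
    refine mul_le_of_le_one_right (by simp only [hF]; linarith) ?_
    rw [Real.exp_le_one_iff]
    linarith [hc0 X hXx]
  have h6 : F x / 3 ≤ F x * Real.exp (-c x) := by
    have : (1 : ℝ) / 3 ≤ Real.exp (-c x) := by
      have e1 : Real.exp (-1) ≤ Real.exp (-c x) := Real.exp_le_exp.2 (by linarith [hcle x le_rfl])
      have e2 : (1 : ℝ) / 3 ≤ Real.exp (-1) := by
        rw [Real.exp_neg, ← one_div]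
        exact one_div_le_one_div_of_le (Real.exp_pos 1) (by linarith [Real.exp_one_lt_d9])
      linarith
    have : 0 ≤ F x := by simp only [hF]; linarith
    nlinarith
  have h7 : F x / 3 ≤ F X := by linarith
  change E x ≤ 24 * L
  simp only [hF] at h7
  linarith

/-- Uniform bounds for Bessel pairs to the right of the turning point `x = n`. -/
lemma exists_weight_action_le {n a : ℝ} (ha : 1 ≤ a) (hn : n = a ^ 3) {x : ℝ} (hx : n ≤ x) :
    ∃ ω : ℝ, 0 < ω ∧ ∀ (u v : ℝ → ℝ) (L : ℝ), IsBesselPair n u v →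
      (∀ᶠ X in atTop, X * u X ^ 2 + v X ^ 2 / X ≤ L) →
      v x ^ 2 / ω + ω * u x ^ 2 ≤ 40000 * L := by
  have ha3 : 1 ≤ a ^ 3 := one_le_pow₀ ha
  have ha4 : 1 ≤ a ^ 4 := one_le_pow₀ ha
  have hx0 : 0 < x := by linarith
  have hL0 : ∀ (u v : ℝ → ℝ) (L : ℝ), (∀ᶠ X in atTop, X * u X ^ 2 + v X ^ 2 / X ≤ L) → 0 ≤ L := by
    intro u v L hL
    obtain ⟨X, hX, hX0⟩ := (hL.and (eventually_gt_atTop (0 : ℝ))).exists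
    refine le_trans ?_ hX
    positivity
  by_cases hx2 : a ^ 6 + 4 * a ^ 4 ≤ x ^ 2
  · refine ⟨√(x ^ 2 - n ^ 2), Real.sqrt_pos.2 ?_, fun u v L h hL => ?_⟩
    · rw [hn]; nlinarith
    · have := h.action_le ha hn hL hx0 hx2
      have := hL0 u v L hL
      linarith
  -- Transition window: it has length at most 2a, and with the frozen weight a² the logarithmic
  -- derivative of the action is at most 3/a in modulus. The loss is therefore at most e⁶ ≤ 729.
  -- With the bound 48 L at the right end s, this gives 48 · 729 ≤ 40000.
  · refine ⟨a ^ 2, by positivity, fun u v L h hL => ?_⟩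
    set s := √(a ^ 6 + 4 * a ^ 4) with hs
    have hs2 : s ^ 2 = a ^ 6 + 4 * a ^ 4 := Real.sq_sqrt (by positivity)
    have hs0 : 0 < s := Real.sqrt_pos.2 (by positivity)
    have hxs : x ≤ s := Real.le_sqrt_of_sq_le (by linarith)
    have hsle : s ≤ a ^ 3 + 2 * a := by
      refine Real.sqrt_le_iff.2 ⟨by positivity, ?_⟩
      nlinarith [sq_nonneg a]
    set E : ℝ → ℝ := fun y => v y ^ 2 / a ^ 2 + a ^ 2 * u y ^ 2 with hE
    set G : ℝ → ℝ := fun y => E y * Real.exp (3 / a * y) with hG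
    have hGd : ∀ y, 0 < y → HasDerivAt G ((2 * (u y * v y) * ((a ^ 4 - (y ^ 2 - n ^ 2)) / (a ^ 2 * y))
        + 3 / a * E y) * Real.exp (3 / a * y)) y := fun y hy0 => by
      have hu := h.hasDerivAt_fst y hy0
      have hv := h.hasDerivAt_snd y hy0
      have he : HasDerivAt (fun y => Real.exp (3 / a * y)) (Real.exp (3 / a * y) * (3 / a)) y := by
        simpa using ((hasDerivAt_id y).const_mul (3 / a)).exp
      have := (((hv.pow 2).div_const (a ^ 2)).add ((hu.pow 2).const_mul (a ^ 2))).mul he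
      convert! this using 1
      simp only [Pi.pow_apply, hE, Pi.add_apply]
      push_cast
      field_simp
      ring
    have hGmono : MonotoneOn G (Set.Icc x s) := by
      refine monotoneOn_of_deriv_nonneg (convex_Icc x s)
        (fun y hy => (hGd y (hx0.trans_le hy.1)).continuousAt.continuousWithinAt)
        (fun y hy => (hGd y (hx0.trans_le
          (interior_subset hy).1)).differentiableAt.differentiableWithinAt)
        (fun y hy => ?_)
      have hy' := interior_subset hy
      have hy0 : 0 < y := hx0.trans_le hy'.1
      rw [(hGd y hy0).deriv]
      refine mul_nonneg ?_ (Real.exp_pos _).le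
      have hny : n ≤ y := hx.trans hy'.1
      have hq0 : 0 ≤ y ^ 2 - n ^ 2 := by
        have : 0 ≤ n := by rw [hn]; positivity
        nlinarith
      have hq1 : y ^ 2 - n ^ 2 ≤ 4 * a ^ 4 := by
        have : y ^ 2 ≤ s ^ 2 := by gcongr; exact hy'.2
        have hn2 : n ^ 2 = a ^ 6 := by rw [hn]; ring
        linarith
      have hE0 : 0 ≤ E y := by positivity
      have hEuv : |2 * (u y * v y)| ≤ E y := by
        have e1 : E y - 2 * (u y * v y) = (v y / a - a * u y) ^ 2 := by
          simp only [hE]; field_simp; ring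
        have e2 : E y + 2 * (u y * v y) = (v y / a + a * u y) ^ 2 := by
          simp only [hE]; field_simp; ring
        rw [abs_le]
        constructor <;> nlinarith [sq_nonneg (v y / a - a * u y), sq_nonneg (v y / a + a * u y)]
      have hr : |(a ^ 4 - (y ^ 2 - n ^ 2)) / (a ^ 2 * y)| ≤ 3 / a := by
        rw [abs_div, abs_of_pos (by positivity : 0 < a ^ 2 * y),
          div_le_div_iff₀ (by positivity) (by positivity)]
        have : |a ^ 4 - (y ^ 2 - n ^ 2)| ≤ 3 * a ^ 4 := by
          rw [abs_le]; constructor <;> linarith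
        calc |a ^ 4 - (y ^ 2 - n ^ 2)| * a ≤ 3 * a ^ 4 * a := by gcongr
          _ = 3 * (a ^ 2 * a ^ 3) := by ring
          _ ≤ 3 * (a ^ 2 * y) := by gcongr; linarith
      have hprod : |2 * (u y * v y) * ((a ^ 4 - (y ^ 2 - n ^ 2)) / (a ^ 2 * y))| ≤ E y * (3 / a) := by
        rw [abs_mul]
        exact mul_le_mul hEuv hr (abs_nonneg _) hE0
      have := (abs_le.1 hprod).1
      linarith
    have hG := hGmono (Set.left_mem_Icc.2 hxs) (Set.right_mem_Icc.2 hxs) hxs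
    have hEs : E s ≤ 48 * L := by
      have h1 := h.action_le ha hn hL hs0 hs2.ge
      have h2 : √(s ^ 2 - n ^ 2) = 2 * a ^ 2 := by
        rw [hs2, hn, show a ^ 6 + 4 * a ^ 4 - (a ^ 3) ^ 2 = (2 * a ^ 2) ^ 2 by ring]
        exact Real.sqrt_sq (by positivity)
      rw [h2] at h1
      have h3 : v s ^ 2 / (2 * a ^ 2) = (v s ^ 2 / a ^ 2) / 2 := by field_simp
      have h4 : 0 ≤ a ^ 2 * u s ^ 2 := by positivity
      have h5 : 0 ≤ v s ^ 2 / a ^ 2 := by positivity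
      simp only [hE]
      linarith
    have hexp : Real.exp (3 / a * s) ≤ 729 * Real.exp (3 / a * x) := by
      have h1 : 3 / a * s ≤ 6 + 3 / a * x := by
        have : s ≤ x + 2 * a := by linarith
        calc 3 / a * s ≤ 3 / a * (x + 2 * a) := by gcongr
          _ = 6 + 3 / a * x := by field_simp; ring
      have h2 : Real.exp 6 ≤ 729 := by
        have : Real.exp 6 = Real.exp 1 ^ 6 := by rw [← Real.exp_nat_mul]; norm_num
        rw [this]
        have h3 : Real.exp 1 ≤ 3 := by linarith [Real.exp_one_lt_d9]
        calc Real.exp 1 ^ 6 ≤ 3 ^ 6 := by gcongr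
          _ = 729 := by norm_num
      calc Real.exp (3 / a * s) ≤ Real.exp (6 + 3 / a * x) := Real.exp_le_exp.2 h1
        _ = Real.exp 6 * Real.exp (3 / a * x) := Real.exp_add _ _
        _ ≤ _ := by gcongr
    have hL' := hL0 u v L hL
    have hEs0 : 0 ≤ E s := by positivity
    have hfin : E x * Real.exp (3 / a * x) ≤ (48 * L * 729) * Real.exp (3 / a * x) := by
      calc E x * Real.exp (3 / a * x) ≤ E s * Real.exp (3 / a * s) := hG
        _ ≤ 48 * L * (729 * Real.exp (3 / a * x)) := by gcongr
        _ = _ := by ring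
    have := le_of_mul_le_mul_right hfin (Real.exp_pos _)
    change E x ≤ 40000 * L
    linarith

/-! ### Behaviour of ladders at infinity -/

/-- The terms added to x(u₀² + u₁²) in F make it a Lyapunov function: F' = -u₀²/(2x²), and for x ≥ 1
it still dominates half of x(u₀² + u₁²). -/
lemma IsBesselLadder.exists_bound_zero {u : ℕ → ℝ → ℝ} (hu : IsBesselLadder u) :
    ∃ B : ℝ, 0 ≤ B ∧ ∀ x, 1 ≤ x → x * (u 0 x ^ 2 + u 1 x ^ 2) ≤ B := by
  set F : ℝ → ℝ := fun x => x * u 1 x ^ 2 - u 0 x * u 1 x + (x + 1 / (2 * x)) * u 0 x ^ 2 with hF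
  have hFd : ∀ x, 0 < x → HasDerivAt F (-(u 0 x ^ 2 / (2 * x ^ 2))) x := fun x hx => by
    have h0 := hu.hasDerivAt 0 x hx
    have h1 := hu.hasDerivAt_succ 0 hx
    have hi : HasDerivAt (fun x : ℝ => 1 / (2 * x)) (-(1 / (2 * x ^ 2))) x := by
      have := (hasDerivAt_inv hx.ne').const_mul (1 / 2)
      convert! this using 1
      · ext y; rw [one_div, mul_inv]; ring
      · field_simp
    have := (((hasDerivAt_id x).mul (h1.pow 2)).sub (h0.mul h1)).add
      (((hasDerivAt_id x).add hi).mul (h0.pow 2))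
    convert! this using 1
    simp
    field_simp
    ring
  have hanti : AntitoneOn F (Set.Ici 1) := by
    refine antitoneOn_of_deriv_nonpos (convex_Ici 1)
      (fun y hy => (hFd y (one_pos.trans_le hy)).continuousAt.continuousWithinAt)
      (fun y hy => (hFd y (one_pos.trans_le
        (interior_subset hy))).differentiableAt.differentiableWithinAt)
      (fun y hy => ?_)
    rw [(hFd y (one_pos.trans_le (interior_subset hy))).deriv]
    have : 0 ≤ u 0 y ^ 2 / (2 * y ^ 2) := by positivity
    linarith
  have hle : ∀ x, 1 ≤ x → x * (u 0 x ^ 2 + u 1 x ^ 2) ≤ 2 * F x := fun x hx => by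
    have h0 : 0 ≤ 1 / (2 * x) * u 0 x ^ 2 := by positivity
    simp only [hF]
    nlinarith [sq_nonneg (u 0 x - u 1 x), sq_nonneg (u 0 x + u 1 x), sq_nonneg (u 0 x),
      sq_nonneg (u 1 x)]
  refine ⟨2 * F 1, le_trans (by positivity) (hle 1 le_rfl), fun x hx => (hle x hx).trans ?_⟩
  have := hanti (Set.mem_Ici.2 le_rfl) (Set.mem_Ici.2 hx) hx
  linarith

lemma IsBesselLadder.tendsto_zero {u : ℕ → ℝ → ℝ} (hu : IsBesselLadder u) (m : ℕ) :
    Tendsto (u m) atTop (𝓝 0) := by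
  obtain ⟨B, hB, h⟩ := hu.exists_bound_zero
  have hsq : ∀ f : ℝ → ℝ, (∀ x, 1 ≤ x → f x ^ 2 ≤ B / x) → Tendsto f atTop (𝓝 0) := by
    intro f hf
    have h1 : Tendsto (fun x => f x ^ 2) atTop (𝓝 0) := by
      refine squeeze_zero' (Eventually.of_forall fun x => sq_nonneg _) ?_
        (tendsto_const_nhds.div_atTop tendsto_id : Tendsto (fun x : ℝ => B / x) atTop (𝓝 0))
      filter_upwards [eventually_ge_atTop 1] with x hx using hf x hx
    have h2 := h1.sqrt
    rw [Real.sqrt_zero] at h2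
    refine squeeze_zero_norm (fun x => ?_) h2
    rw [Real.sqrt_sq_eq_abs, Real.norm_eq_abs]
  have key : Tendsto (u m) atTop (𝓝 0) ∧ Tendsto (u (m + 1)) atTop (𝓝 0) := by
    induction m with
    | zero =>
      refine ⟨hsq _ fun x hx => ?_, hsq _ fun x hx => ?_⟩ <;>
      · have := h x hx
        rw [le_div_iff₀ (by linarith)]
        nlinarith [sq_nonneg (u 0 x), sq_nonneg (u 1 x)]
    | succ m ih =>
      refine ⟨ih.2, ?_⟩
      have h1 : Tendsto (fun x : ℝ => 2 * ((m : ℝ) + 1) / x * u (m + 1) x - u m x) atTop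
          (𝓝 (0 * 0 - 0)) :=
        ((tendsto_const_nhds.div_atTop tendsto_id).mul ih.2).sub ih.1
      rw [mul_zero, sub_zero] at h1
      refine h1.congr' ?_
      filter_upwards [eventually_gt_atTop 0] with x hx
      linarith [hu.recurrence m x hx]
  exact key.1

/-- L does not depend on m, because x(u_m² + u_{m+1}²) has the same asymptotics for all m: by the
recurrence, consecutive expressions differ by 2(m+1) u_{m+1} (u_{m+2} - u_m), which tends to 0. -/
lemma IsBesselLadder.exists_eventually_le {u : ℕ → ℝ → ℝ} (hu : IsBesselLadder u) :
    ∃ L : ℝ, ∀ m, ∀ᶠ X in atTop, X * u m X ^ 2 + ladderEuler u m X ^ 2 / X ≤ L := by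
  obtain ⟨B, hB, h⟩ := hu.exists_bound_zero
  refine ⟨B + 1, fun m => ?_⟩
  have key : Tendsto (fun x => x * (u m x ^ 2 + u (m + 1) x ^ 2) - x * (u 0 x ^ 2 + u 1 x ^ 2))
      atTop (𝓝 0) := by
    induction m with
    | zero => simp
    | succ m ih =>
      have h1 := ((hu.tendsto_zero (m + 1)).const_mul (2 * ((m : ℝ) + 1))).mul
        ((hu.tendsto_zero (m + 2)).sub (hu.tendsto_zero m))
      have h2 := ih.add h1
      simp only [mul_zero, sub_zero, add_zero] at h2
      refine h2.congr' ?_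
      filter_upwards [eventually_gt_atTop 0] with x hx
      have hr := hu.recurrence m x hx
      have hr' : 2 * ((m : ℝ) + 1) * u (m + 1) x = x * (u m x + u (m + 2) x) := by
        rw [hr]; field_simp
      rw [hr']
      ring
  have h3 : Tendsto (fun x : ℝ => (m : ℝ) ^ 2 / x * u m x ^ 2 - 2 * m * (u m x * u (m + 1) x)) atTop
      (𝓝 ((0 : ℝ) * 0 ^ 2 - 2 * m * (0 * 0))) :=
    ((tendsto_const_nhds.div_atTop tendsto_id).mul ((hu.tendsto_zero m).pow 2)).sub
      (((hu.tendsto_zero m).mul (hu.tendsto_zero (m + 1))).const_mul _)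
  have h4 := key.add h3
  simp only [mul_zero, sub_zero, add_zero, zero_mul] at h4
  filter_upwards [h4.eventually (gt_mem_nhds one_pos), eventually_ge_atTop 1] with x hx hx1
  have hx0 : 0 < x := by linarith
  have h5 := h x hx1
  have h6 : x * u m x ^ 2 + ladderEuler u m x ^ 2 / x = x * (u m x ^ 2 + u (m + 1) x ^ 2) +
      ((m : ℝ) ^ 2 / x * u m x ^ 2 - 2 * m * (u m x * u (m + 1) x)) := by
    rw [ladderEuler]
    field_simp
    ring
  linarith

/-- Products of a cylinder function and an Euler derivative are bounded to the right of the turning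
point, uniformly in the order. -/
lemma IsBesselLadder.exists_abs_mul_euler_le {u w : ℕ → ℝ → ℝ} (hu : IsBesselLadder u)
    (hw : IsBesselLadder w) :
    ∃ K : ℝ, ∀ m : ℕ, 1 ≤ m → ∀ x : ℝ, (m : ℝ) ≤ x → |u m x * ladderEuler w m x| ≤ K := by
  obtain ⟨L₁, h₁⟩ := hu.exists_eventually_le
  obtain ⟨L₂, h₂⟩ := hw.exists_eventually_le
  refine ⟨40000 * max L₁ L₂, fun m hm x hx => ?_⟩
  have hm1 : (1 : ℝ) ≤ m := by exact_mod_cast hm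
  -- The weight ω depends only on the order and on x, so it serves both ladders and cancels in the
  -- product of the two bounds.
  obtain ⟨ω, hω, H⟩ := exists_weight_action_le (a := (m : ℝ) ^ (1 / 3 : ℝ))
    (Real.one_le_rpow hm1 (by norm_num))
    (by rw [← Real.rpow_natCast, ← Real.rpow_mul (by positivity)]; norm_num) hx
  have e₁ := H _ _ _ (hu.isBesselPair m)
    ((h₁ m).mono fun X hX => hX.trans (le_max_left L₁ L₂))
  have e₂ := H _ _ _ (hw.isBesselPair m)
    ((h₂ m).mono fun X hX => hX.trans (le_max_right L₁ L₂))
  set K := 40000 * max L₁ L₂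
  have p₁ : ω * u m x ^ 2 ≤ K := by
    have : 0 ≤ ladderEuler u m x ^ 2 / ω := by positivity
    linarith
  have p₂ : ladderEuler w m x ^ 2 / ω ≤ K := by
    have : 0 ≤ ω * w m x ^ 2 := by positivity
    linarith
  have hK : 0 ≤ K := le_trans (by positivity) p₁
  refine abs_le_of_sq_le_sq (?_ : _ ≤ K ^ 2) hK
  calc (u m x * ladderEuler w m x) ^ 2 = (ω * u m x ^ 2) * (ladderEuler w m x ^ 2 / ω) := by
        field_simp
    _ ≤ K * K := by gcongr
    _ = K ^ 2 := by ring

end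

section

open Filter Topology

/-! ### Behaviour at the origin and the Wronskian -/

lemma continuous_besselPhi (m : ℕ) : Continuous (besselPhi m) :=
  continuous_iff_continuousAt.2 fun y => (hasDerivAt_besselPhi m y).continuousAt

lemma continuous_besselPsi (m : ℕ) : Continuous (besselPsi m) :=
  continuous_iff_continuousAt.2 fun y =>
    (hasDerivAt_tsum_mul_pow (abs_besselCoeffY_le m) y).continuousAt

lemma continuous_besselJ (m : ℕ) : Continuous (besselJ m) := by
  have : besselJ m = fun x => (x / 2) ^ m * besselPhi m ((x / 2) ^ 2) := funext (besselJ_eq m)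
  rw [this]
  have := continuous_besselPhi m
  fun_prop

lemma continuous_besselReg (m : ℕ) : Continuous (besselReg m) := by
  have := continuous_besselPsi m
  unfold besselReg
  fun_prop

lemma besselJ_zero_zero : besselJ 0 0 = 1 := by
  rw [besselJ_eq, besselPhi, tsum_eq_single 0 (fun k hk => by simp [hk])]
  simp [besselCoeffJ]

lemma besselJ_succ_zero (m : ℕ) : besselJ (m + 1) 0 = 0 := by
  rw [besselJ_eq]; simp

lemma besselSing_zero (x : ℝ) : besselSing 0 x = 0 := by simp [besselSing]

lemma besselSing_one (x : ℝ) : besselSing 1 x = 2 / x := by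
  simp [besselSing]

lemma IsBesselPair.wronskian_eq {n : ℝ} {u v y w : ℝ → ℝ} (h : IsBesselPair n u v)
    (h' : IsBesselPair n y w) {s t : ℝ} (hs : 0 < s) (ht : 0 < t) :
    u s * w s - y s * v s = u t * w t - y t * v t := by
  have hd : ∀ x ∈ Set.Ioi (0 : ℝ), HasDerivAt (fun x => u x * w x - y x * v x) 0 x := by
    intro x hx
    have := ((h.hasDerivAt_fst x hx).mul (h'.hasDerivAt_snd x hx)).sub
      ((h'.hasDerivAt_fst x hx).mul (h.hasDerivAt_snd x hx))
    convert! this using 1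
    ring
  exact (convex_Ioi (0 : ℝ)).is_const_of_fderivWithin_eq_zero (𝕜 := ℝ)
    (fun x hx => (hd x hx).differentiableAt.differentiableWithinAt)
    (fun x hx => by
      rw [fderivWithin_of_isOpen isOpen_Ioi hx]
      ext
      simp [(hd x hx).deriv]) hs ht

/-- The logarithms cancel in the Wronskian, leaving a function g that is continuous at 0 with g(0) =
2/π. Since the Wronskian is constant on (0, ∞), this is its value. -/
lemma wronskian_zero {x : ℝ} (hx : 0 < x) :
    x * (besselJ 1 x * besselY 0 x - besselJ 0 x * besselY 1 x) = 2 / Real.pi := by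
  set g : ℝ → ℝ := fun x => 2 / Real.pi * besselJ 0 x
    + x / Real.pi * (besselJ 0 x * besselReg 1 x - besselJ 1 x * besselReg 0 x) with hg
  have hgc : Continuous g := by
    have h0 := continuous_besselJ 0
    have h1 := continuous_besselJ 1
    have h2 := continuous_besselReg 0
    have h3 := continuous_besselReg 1
    fun_prop
  have hW : ∀ t, 0 < t → t * (besselJ 1 t * besselY 0 t - besselJ 0 t * besselY 1 t) = g t := by
    intro t ht
    rw [besselY_eq, besselY_eq, besselSing_zero, besselSing_one]
    simp only [hg]
    field_simp
    ring
  have hconst : ∀ t, 0 < t → g t = g x := by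
    intro t ht
    have := (isBesselLadder_besselJ.isBesselPair 0).wronskian_eq
      (isBesselLadder_besselY.isBesselPair 0) ht hx
    rw [← hW t ht, ← hW x hx]
    simp only [ladderEuler, Nat.cast_zero, zero_mul, zero_sub, zero_add] at this
    linarith
  have h0 : Tendsto g (𝓝[>] 0) (𝓝 (g 0)) := hgc.continuousAt.continuousWithinAt
  have h1 : Tendsto g (𝓝[>] 0) (𝓝 (g x)) :=
    tendsto_const_nhds.congr' (by
      filter_upwards [self_mem_nhdsWithin] with t ht using (hconst t ht).symm)
  rw [hW x hx, tendsto_nhds_unique h1 h0]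
  simp [hg, besselJ_zero_zero]

lemma wronskian_bessel (m : ℕ) {x : ℝ} (hx : 0 < x) :
    besselJ m x * ladderEuler besselY m x - besselY m x * ladderEuler besselJ m x
      = 2 / Real.pi := by
  have key : x * (besselJ (m + 1) x * besselY m x - besselJ m x * besselY (m + 1) x)
      = 2 / Real.pi := by
    induction m with
    | zero => exact wronskian_zero hx
    | succ m ih =>
      rw [← ih]
      have h1 := besselJ_recurrence m hx.ne'
      have h2 := besselY_recurrence m hx.ne'
      linear_combination x * besselY (m + 1) x * h1 - x * besselJ (m + 1) x * h2
  rw [← key, ladderEuler, ladderEuler]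
  ring

/-! ### Bounds to the left of the turning point -/

lemma IsBesselPair.sub_mul {n : ℝ} {u v y w : ℝ → ℝ} (h : IsBesselPair n u v)
    (h' : IsBesselPair n y w) (c : ℝ) :
    IsBesselPair n (fun x => y x - c * u x) (fun x => w x - c * v x) := by
  refine ⟨fun x hx => ?_, fun x hx => ?_⟩
  · convert! (h'.hasDerivAt_fst x hx).sub ((h.hasDerivAt_fst x hx).const_mul c) using 1
    ring
  · convert! (h'.hasDerivAt_snd x hx).sub ((h.hasDerivAt_snd x hx).const_mul c) using 1
    ring

lemma IsBesselPair.hasDerivAt_mul {n : ℝ} {u v : ℝ → ℝ} (h : IsBesselPair n u v) {x : ℝ}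
    (hx : 0 < x) :
    HasDerivAt (fun x => u x * v x) ((v x ^ 2 + (n ^ 2 - x ^ 2) * u x ^ 2) / x) x := by
  convert! (h.hasDerivAt_fst x hx).mul (h.hasDerivAt_snd x hx) using 1
  field_simp
  ring

lemma IsBesselPair.hasDerivAt_sq {n : ℝ} {u v : ℝ → ℝ} (h : IsBesselPair n u v) {x : ℝ}
    (hx : 0 < x) : HasDerivAt (fun x => u x ^ 2) (2 * (u x * v x) / x) x := by
  convert! (h.hasDerivAt_fst x hx).pow 2 using 1
  simp
  ring

/-- Left of the turning point the coefficient n² - x² is nonnegative, so (uv)' = (v² + (n² -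
x²)u²)/x is too. One sign condition at an endpoint thus controls the whole interval. -/
lemma IsBesselPair.monotoneOn_mul {n : ℝ} {u v : ℝ → ℝ} (h : IsBesselPair n u v) :
    MonotoneOn (fun x => u x * v x) (Set.Ioc 0 n) := by
  refine monotoneOn_of_deriv_nonneg (convex_Ioc 0 n)
    (fun x hx => (h.hasDerivAt_mul hx.1).continuousAt.continuousWithinAt)
    (fun x hx => (h.hasDerivAt_mul
      (interior_subset hx).1).differentiableAt.differentiableWithinAt) (fun x hx => ?_)
  have hx' := interior_subset hx
  rw [(h.hasDerivAt_mul hx'.1).deriv]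
  have h1 : 0 ≤ n ^ 2 - x ^ 2 := by nlinarith [hx'.1, hx'.2]
  have h2 := hx'.1
  positivity

/-- If y dy > 0, then j dy and y dj do not have opposite signs, while they differ by 2/π > 1/2. One
of them exceeds 1/2 in modulus, and the matching choice c = y/j or c = dy/dj annihilates one factor
with |c| ≤ 2K. -/
lemma exists_sub_mul_product_nonpos {j dj y dy K : ℝ} (hW : j * dy - y * dj = 2 / Real.pi)
    (hjj : 0 ≤ j * dj) (hyy : |y * dy| ≤ K) :
    ∃ c, |c| ≤ 2 * K ∧ (y - c * j) * (dy - c * dj) ≤ 0 := by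
  have hK : 0 ≤ K := (abs_nonneg _).trans hyy
  have hpi : 1 / 2 < 2 / Real.pi := by
    rw [div_lt_div_iff₀ two_pos Real.pi_pos]; linarith [Real.pi_lt_four]
  by_cases h0 : y * dy ≤ 0
  · exact ⟨0, by simpa using hK, by simpa using h0⟩
  push Not at h0
  have hprod : 0 ≤ (j * dy) * (y * dj) := by
    have : (j * dy) * (y * dj) = (j * dj) * (y * dy) := by ring
    rw [this]; positivity
  rcases lt_or_ge 0 (j * dy) with h1 | h1
  · have h2 : 0 ≤ y * dj := by
      by_contra h; push Not at h; nlinarith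
    have h3 : 1 / 2 < j * dy := by linarith
    have hj : j ≠ 0 := by rintro rfl; simp at h1
    have hdy : dy ≠ 0 := by rintro rfl; simp at h1
    refine ⟨y / j, ?_, by rw [div_mul_cancel₀ _ hj]; simp⟩
    rw [show y / j = (y * dy) / (j * dy) by field_simp, abs_div, div_le_iff₀ (abs_pos.2 h1.ne'),
      abs_of_pos h1]
    nlinarith
  · have h3 : y * dj < -(1 / 2) := by linarith
    have hy : y ≠ 0 := by rintro rfl; simp at h0
    have hdj : dj ≠ 0 := by rintro rfl; norm_num at h3
    refine ⟨dy / dj, ?_, by rw [div_mul_cancel₀ _ hdj]; simp⟩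
    rw [show dy / dj = (y * dy) / (y * dj) by field_simp, abs_div,
      div_le_iff₀ (abs_pos.2 (mul_ne_zero hy hdj)), abs_of_neg (by linarith : y * dj < 0)]
    nlinarith

/-- Algebraic conversion of sign information into weighted product bounds. -/
lemma weighted_products {j dj z dz c K : ℝ} (hK : 1 ≤ K) (hc : |c| ≤ 2 * K)
    (hW : j * dz - z * dj = 2 / Real.pi) (hjj : 0 ≤ j * dj) (hjK : j * dj ≤ K)
    (hzz : z * dz ≤ 0) (hj : j ≠ 0) :
    |j * dj| ≤ 9 * K ^ 3 * (|j| / max |j| |z|) ∧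
    |j * (dz + c * dj)| ≤ 9 * K ^ 3 ∧
    |(z + c * j) * dj| ≤ 9 * K ^ 3 ∧
    |(z + c * j) * (dz + c * dj)| * (|j| / max |j| |z|) ≤ 9 * K ^ 3 := by
  have hpi : 2 / Real.pi < 1 := by
    rw [div_lt_one Real.pi_pos]; linarith [Real.pi_gt_three]
  have hpi0 : 0 < 2 / Real.pi := div_pos two_pos Real.pi_pos
  -- The two terms of the Wronskian add up in modulus instead of cancelling, so each is at most 2/π
  -- < 1.
  have hprod : (j * dz) * (z * dj) ≤ 0 := by
    have : (j * dz) * (z * dj) = (j * dj) * (z * dz) := by ring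
    rw [this]
    exact mul_nonpos_of_nonneg_of_nonpos hjj hzz
  have h1 : 0 ≤ j * dz := by
    by_contra h; push Not at h; nlinarith
  have h2 : z * dj ≤ 0 := by
    by_contra h; push Not at h; nlinarith
  have a1 : |j * dz| ≤ 1 := by rw [abs_of_nonneg h1]; linarith
  have a2 : |z * dj| ≤ 1 := by rw [abs_of_nonpos h2]; linarith
  have a3 : |j * dj| ≤ K := by rwa [abs_of_nonneg hjj]
  have hK2 : K ≤ K ^ 2 := by nlinarith
  have hK3 : K ^ 2 ≤ K ^ 3 := by nlinarith [sq_nonneg K]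
  have hj0 : 0 < |j| := abs_pos.2 hj
  have hmax : 0 < max |j| |z| := lt_max_of_lt_left hj0
  set e := |j| / max |j| |z| with he
  have he1 : e ≤ 1 := by rw [he, div_le_one hmax]; exact le_max_left _ _
  have he0 : 0 < e := by positivity
  have cj : |c * (j * dj)| ≤ 2 * K * K := by
    rw [abs_mul]; gcongr
  refine ⟨?_, ?_, ?_, ?_⟩
  · rcases le_total |z| |j| with h | h
    · rw [he, max_eq_left h, div_self hj0.ne']
      linarith
    · have : |j * dj| = |z * dj| * e := by
        rw [he, max_eq_right h, abs_mul, abs_mul]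
        have : |z| ≠ 0 := (hj0.trans_le h).ne'
        field_simp
      rw [this]
      gcongr
      linarith
  · rw [show j * (dz + c * dj) = j * dz + c * (j * dj) by ring]
    refine (abs_add_le _ _).trans ?_
    nlinarith
  · rw [show (z + c * j) * dj = z * dj + c * (j * dj) by ring]
    refine (abs_add_le _ _).trans ?_
    nlinarith
  · have hze : |z * dz| * e ≤ 1 := by
      rw [abs_mul, he]
      have e1 : |z| * (|j| / max |j| |z|) ≤ |j| := by
        rw [mul_div_assoc', div_le_iff₀ hmax, mul_comm]
        gcongr
        exact le_max_right _ _
      calc |z| * |dz| * (|j| / max |j| |z|) = |z| * (|j| / max |j| |z|) * |dz| := by ring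
        _ ≤ |j| * |dz| := by gcongr
        _ ≤ 1 := by rwa [← abs_mul]
    have hrest : |c * (j * dz) + c * (z * dj) + c * (c * (j * dj))| ≤
        2 * K * 1 + 2 * K * 1 + 2 * K * (2 * K * K) := by
      refine (abs_add_le _ _).trans (add_le_add ((abs_add_le _ _).trans (add_le_add ?_ ?_)) ?_)
      · rw [abs_mul]; gcongr
      · rw [abs_mul]; gcongr
      · rw [abs_mul]; gcongr
    rw [show (z + c * j) * (dz + c * dj) = z * dz + (c * (j * dz) + c * (z * dj) + c * (c * (j * dj)))
      by ring]
    calc |z * dz + (c * (j * dz) + c * (z * dj) + c * (c * (j * dj)))| * e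
        ≤ (|z * dz| + |c * (j * dz) + c * (z * dj) + c * (c * (j * dj))|) * e := by
          gcongr; exact abs_add_le _ _
      _ = |z * dz| * e + |c * (j * dz) + c * (z * dj) + c * (c * (j * dj))| * e := by ring
      _ ≤ 1 + (2 * K * 1 + 2 * K * 1 + 2 * K * (2 * K * K)) * 1 := by gcongr
      _ ≤ 9 * K ^ 3 := by nlinarith

/-- Weighted product bounds for a recessive solution `j` and another solution `y`. -/
structure WeightedProducts (K e j dj y dy : ℝ) : Prop where
  fst_fst : |j * dj| ≤ K * e
  fst_snd : |j * dy| ≤ K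
  snd_fst : |y * dj| ≤ K
  snd_snd : |y * dy| * e ≤ K

lemma WeightedProducts.mono {K K' e j dj y dy : ℝ} (h : WeightedProducts K e j dj y dy)
    (he : 0 ≤ e) (hK : K ≤ K') : WeightedProducts K' e j dj y dy :=
  ⟨h.1.trans (by gcongr), h.2.trans hK, h.3.trans hK, h.4.trans hK⟩

/-- The sign of j dj is fixed at 0 and that of z dz, z = y - c j, at n; monotonicity of the products
extends both to (0, n]. Hence j² increases and z² decreases, which makes |j| / max(|j|, |z|)
monotone. -/
lemma IsBesselPair.exists_weight_left {n K : ℝ} {j dj y dy : ℝ → ℝ} (hn : 0 < n)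
    (hj : IsBesselPair n j dj) (hy : IsBesselPair n y dy) (hjc : Continuous fun x => j x * dj x)
    (h0 : j 0 * dj 0 = 0) (hW : ∀ x, 0 < x → j x * dy x - y x * dj x = 2 / Real.pi) (hK : 1 ≤ K)
    (hjK : |j n * dj n| ≤ K) (hyK : |y n * dy n| ≤ K) :
    ∃ e : ℝ → ℝ, (∀ x ∈ Set.Ioc 0 n, 0 < e x ∧ e x ≤ 1) ∧ MonotoneOn e (Set.Ioc 0 n) ∧
      ∀ x ∈ Set.Ioc 0 n, WeightedProducts (9 * K ^ 3) (e x) (j x) (dj x) (y x) (dy x) := by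
  have hjj : ∀ x ∈ Set.Ioc 0 n, 0 ≤ j x * dj x := by
    intro x hx
    have h1 : Tendsto (fun x => j x * dj x) (𝓝[>] 0) (𝓝 0) := by
      have := hjc.continuousAt.continuousWithinAt (x := 0) (s := Set.Ioi 0)
      rwa [ContinuousWithinAt, h0] at this
    refine le_of_tendsto h1 ?_
    filter_upwards [Ioc_mem_nhdsGT hx.1] with t ht
    exact hj.monotoneOn_mul ⟨ht.1, ht.2.trans hx.2⟩ hx ht.2
  have hnn : n ∈ Set.Ioc 0 n := ⟨hn, le_rfl⟩
  obtain ⟨c, hc, hcz⟩ := exists_sub_mul_product_nonpos (hW n hn) (hjj n hnn) hyK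
  have hz := hj.sub_mul hy c
  have hzz : ∀ x ∈ Set.Ioc 0 n, (y x - c * j x) * (dy x - c * dj x) ≤ 0 := fun x hx =>
    (hz.monotoneOn_mul hx hnn hx.2).trans hcz
  have hjsq : MonotoneOn (fun x => j x ^ 2) (Set.Ioc 0 n) := by
    refine monotoneOn_of_deriv_nonneg (convex_Ioc 0 n)
      (fun x hx => (hj.hasDerivAt_sq hx.1).continuousAt.continuousWithinAt)
      (fun x hx => (hj.hasDerivAt_sq
        (interior_subset hx).1).differentiableAt.differentiableWithinAt) (fun x hx => ?_)
    have hx' := interior_subset hx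
    rw [(hj.hasDerivAt_sq hx'.1).deriv]
    have := hjj x hx'
    have := hx'.1
    positivity
  have hzsq : AntitoneOn (fun x => (y x - c * j x) ^ 2) (Set.Ioc 0 n) := by
    refine antitoneOn_of_deriv_nonpos (convex_Ioc 0 n)
      (fun x hx => (hz.hasDerivAt_sq hx.1).continuousAt.continuousWithinAt)
      (fun x hx => (hz.hasDerivAt_sq
        (interior_subset hx).1).differentiableAt.differentiableWithinAt) (fun x hx => ?_)
    have hx' := interior_subset hx
    rw [(hz.hasDerivAt_sq hx'.1).deriv]
    exact div_nonpos_of_nonpos_of_nonneg (by linarith [hzz x hx']) hx'.1.le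
  -- A zero of j would, by monotonicity of j², force j = 0 on all of (0, x], against the nonzero
  -- Wronskian.
  have hj0 : ∀ x ∈ Set.Ioc 0 n, j x ≠ 0 := by
    intro x hx hjx
    have hzero : ∀ t ∈ Set.Ioc 0 x, j t = 0 := fun t ht => by
      have := hjsq ⟨ht.1, ht.2.trans hx.2⟩ hx ht.2
      simp only [hjx] at this
      exact pow_eq_zero_iff two_ne_zero |>.1 (le_antisymm (by simpa using this) (sq_nonneg _))
    have hx2 : 0 < x / 2 := half_pos hx.1
    have hev : j =ᶠ[𝓝 (x / 2)] fun _ => 0 := by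
      filter_upwards [Ioo_mem_nhds hx2 (half_lt_self hx.1)] with t ht
      exact hzero t ⟨ht.1, ht.2.le⟩
    have hd : dj (x / 2) / (x / 2) = 0 :=
      (hj.hasDerivAt_fst _ hx2).unique ((hasDerivAt_const _ (0 : ℝ)).congr_of_eventuallyEq hev)
    have hd' : dj (x / 2) = 0 := by
      rcases div_eq_zero_iff.1 hd with h | h
      · exact h
      · exact absurd h hx2.ne'
    have := hW _ hx2
    rw [hd', hzero _ ⟨hx2, (half_lt_self hx.1).le⟩] at this
    have hpi : 0 < 2 / Real.pi := div_pos two_pos Real.pi_pos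
    simp only [zero_mul, mul_zero, sub_zero] at this
    linarith
  refine ⟨fun x => |j x| / max |j x| |y x - c * j x|, fun x hx => ?_, fun x hx t ht hxt => ?_,
    fun x hx => ?_⟩
  · have h1 := abs_pos.2 (hj0 x hx)
    have h2 : 0 < max |j x| |y x - c * j x| := lt_max_of_lt_left h1
    exact ⟨by positivity, (div_le_one h2).2 (le_max_left _ _)⟩
  · have h1 := abs_pos.2 (hj0 x hx)
    have h2 : 0 < max |j x| |y x - c * j x| := lt_max_of_lt_left h1
    have h1' := abs_pos.2 (hj0 t ht)
    have h2' : 0 < max |j t| |y t - c * j t| := lt_max_of_lt_left h1'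
    have h3 : |j x| ≤ |j t| := sq_le_sq.1 (hjsq hx ht hxt)
    have h4 : |y t - c * j t| ≤ |y x - c * j x| := sq_le_sq.1 (hzsq hx ht hxt)
    simp only
    rw [div_le_div_iff₀ h2 h2', mul_max_of_nonneg _ _ h1.le, mul_max_of_nonneg _ _ h1'.le]
    refine max_le ?_ ?_
    · refine le_max_of_le_left ?_
      rw [mul_comm]
    · refine le_max_of_le_right ?_
      gcongr
  · have hWx : j x * (dy x - c * dj x) - (y x - c * j x) * dj x = 2 / Real.pi := by
      rw [← hW x hx.1]; ring
    have := weighted_products hK hc hWx (hjj x hx)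
      ((hj.monotoneOn_mul hx hnn hx.2).trans ((le_abs_self _).trans hjK)) (hzz x hx) (hj0 x hx)
    simp only [sub_add_cancel] at this
    exact ⟨this.1, this.2.1, this.2.2.1, this.2.2.2⟩

/-! ### The uniform weight -/

lemma exists_bound_near_zero :
    ∃ B : ℝ, ∀ x ∈ Set.Ioc (0 : ℝ) 1, |besselJ 0 x| ≤ B ∧ |besselJ 1 x| ≤ B ∧
      |x * besselY 0 x| ≤ B ∧ |x * besselY 1 x| ≤ B := by
  have hb : ∀ f : ℝ → ℝ, Continuous f → ∃ B : ℝ, ∀ x ∈ Set.Ioc (0 : ℝ) 1, |f x| ≤ B := by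
    intro f hf
    obtain ⟨B, hB⟩ := isCompact_Icc.exists_bound_of_continuousOn (s := Set.Icc (0 : ℝ) 1)
      hf.continuousOn
    exact ⟨B, fun x hx => hB x ⟨hx.1.le, hx.2⟩⟩
  have hJ := continuous_besselJ
  have hR := continuous_besselReg
  have hl := Real.continuous_mul_log
  obtain ⟨B₀, h₀⟩ := hb (besselJ 0) (hJ 0)
  obtain ⟨B₁, h₁⟩ := hb (besselJ 1) (hJ 1)
  obtain ⟨B₂, h₂⟩ := hb (fun x => 2 / Real.pi * (x * Real.log x - x * Real.log 2
      + x * Real.eulerMascheroniConstant) * besselJ 0 x - x / Real.pi * besselReg 0 x)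
    (by have := hJ 0; have := hR 0; fun_prop)
  obtain ⟨B₃, h₃⟩ := hb (fun x => 2 / Real.pi * (x * Real.log x - x * Real.log 2
      + x * Real.eulerMascheroniConstant) * besselJ 1 x - 2 / Real.pi - x / Real.pi * besselReg 1 x)
    (by have := hJ 1; have := hR 1; fun_prop)
  refine ⟨max (max B₀ B₁) (max B₂ B₃), fun x hx => ⟨?_, ?_, ?_, ?_⟩⟩
  · exact (h₀ x hx).trans ((le_max_left _ _).trans (le_max_left _ _))
  · exact (h₁ x hx).trans ((le_max_right _ _).trans (le_max_left _ _))
  · refine le_trans (le_of_eq ?_) ((h₂ x hx).trans ((le_max_left _ _).trans (le_max_right _ _)))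
    congr 1
    rw [besselY_eq, besselSing_zero, Real.log_div hx.1.ne' two_ne_zero]
    ring
  · refine le_trans (le_of_eq ?_) ((h₃ x hx).trans ((le_max_right _ _).trans (le_max_right _ _)))
    congr 1
    rw [besselY_eq, besselSing_one, Real.log_div hx.1.ne' two_ne_zero]
    have := hx.1.ne'
    field_simp

/-- Order zero has no interval left of the turning point. Near 0 the weight x absorbs the logarithm
of Y₀ and the pole of Y₁; for x ≥ 1 all four functions are O(x^(-1/2)). -/
lemma exists_weight_order_zero :
    ∃ K : ℝ, ∀ x, 0 < x → WeightedProducts K (min 1 x) (besselJ 0 x) (ladderEuler besselJ 0 x)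
      (besselY 0 x) (ladderEuler besselY 0 x) := by
  obtain ⟨B, hB⟩ := exists_bound_near_zero
  obtain ⟨B₁, hB₁, h₁⟩ := isBesselLadder_besselJ.exists_bound_zero
  obtain ⟨B₂, hB₂, h₂⟩ := isBesselLadder_besselY.exists_bound_zero
  refine ⟨max (B ^ 2) (max B₁ B₂), fun x hx => ?_⟩
  simp only [ladderEuler, Nat.cast_zero, zero_mul, zero_sub, zero_add]
  rcases le_total x 1 with hx1 | hx1
  · rw [min_eq_right hx1]
    obtain ⟨b₀, b₁, b₂, b₃⟩ := hB x ⟨hx, hx1⟩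
    have hB0 : 0 ≤ B := (abs_nonneg _).trans b₀
    refine WeightedProducts.mono (K := B ^ 2) ⟨?_, ?_, ?_, ?_⟩ hx.le (le_max_left _ _)
    · rw [show besselJ 0 x * -(x * besselJ 1 x) = -(besselJ 0 x * besselJ 1 x * x) by ring, abs_neg,
        abs_mul, abs_mul, abs_of_pos hx, sq]
      gcongr
    · rw [mul_neg, abs_neg, abs_mul, sq]
      gcongr
    · rw [show besselY 0 x * -(x * besselJ 1 x) = -((x * besselY 0 x) * besselJ 1 x) by ring,
        abs_neg, abs_mul, sq]
      gcongr
    · rw [show |besselY 0 x * -(x * besselY 1 x)| * x = |besselY 0 x * -(x * besselY 1 x)| * |x| by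
        rw [abs_of_pos hx], ← abs_mul,
        show besselY 0 x * -(x * besselY 1 x) * x = -((x * besselY 0 x) * (x * besselY 1 x)) by ring,
        abs_neg, abs_mul, sq]
      gcongr
  · rw [min_eq_left hx1]
    set M := max B₁ B₂ with hM
    have hM0 : 0 ≤ M := hB₁.trans (le_max_left _ _)
    have key : ∀ a b : ℝ, x * a ^ 2 ≤ M → x * b ^ 2 ≤ M → |a * -(x * b)| ≤ M := by
      intro a b ha hb
      refine abs_le_of_sq_le_sq ?_ hM0
      calc (a * -(x * b)) ^ 2 = (x * a ^ 2) * (x * b ^ 2) := by ring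
        _ ≤ M * M := by gcongr
        _ = M ^ 2 := by ring
    have j₀ : x * besselJ 0 x ^ 2 ≤ M := by
      have := h₁ x hx1
      have : 0 ≤ x * besselJ 1 x ^ 2 := by positivity
      linarith [le_max_left B₁ B₂]
    have j₁ : x * besselJ 1 x ^ 2 ≤ M := by
      have := h₁ x hx1
      have : 0 ≤ x * besselJ 0 x ^ 2 := by positivity
      linarith [le_max_left B₁ B₂]
    have y₀ : x * besselY 0 x ^ 2 ≤ M := by
      have := h₂ x hx1
      have : 0 ≤ x * besselY 1 x ^ 2 := by positivity
      linarith [le_max_right B₁ B₂]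
    have y₁ : x * besselY 1 x ^ 2 ≤ M := by
      have := h₂ x hx1
      have : 0 ≤ x * besselY 0 x ^ 2 := by positivity
      linarith [le_max_right B₁ B₂]
    refine WeightedProducts.mono (K := M) ⟨?_, ?_, ?_, ?_⟩ zero_le_one (le_max_right _ _)
    · rw [mul_one]; exact key _ _ j₀ j₁
    · exact key _ _ j₀ y₁
    · exact key _ _ y₀ j₁
    · rw [mul_one]; exact key _ _ y₀ y₁

/-- There is a nondecreasing weight `E_m ≤ 1` with `x J J' = O(E)`, `x Y Y' = O(1/E)`,
`x J Y' = O(1)` and `x Y J' = O(1)`, uniformly in the order `m`. -/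
theorem exists_bessel_weight :
    ∃ (K : ℝ) (E : ℕ → ℝ → ℝ), 1 ≤ K ∧ ∀ m, (∀ x, 0 < x → 0 < E m x ∧ E m x ≤ 1) ∧
      MonotoneOn (E m) (Set.Ioi 0) ∧
      ∀ x, 0 < x → WeightedProducts K (E m x) (besselJ m x) (ladderEuler besselJ m x)
        (besselY m x) (ladderEuler besselY m x) := by
  obtain ⟨K₀, h₀⟩ := exists_weight_order_zero
  have hJ := isBesselLadder_besselJ
  have hY := isBesselLadder_besselY
  obtain ⟨A₁, hA₁⟩ := hJ.exists_abs_mul_euler_le hJ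
  obtain ⟨A₂, hA₂⟩ := hJ.exists_abs_mul_euler_le hY
  obtain ⟨A₃, hA₃⟩ := hY.exists_abs_mul_euler_le hJ
  obtain ⟨A₄, hA₄⟩ := hY.exists_abs_mul_euler_le hY
  obtain ⟨A, hA, a₁, a₂, a₃, a₄⟩ : ∃ A : ℝ, 1 ≤ A ∧ A₁ ≤ A ∧ A₂ ≤ A ∧ A₃ ≤ A ∧ A₄ ≤ A :=
    ⟨max 1 (max (max A₁ A₂) (max A₃ A₄)), by simp, by simp, by simp, by simp, by simp⟩
  have hA3 : A ≤ 9 * A ^ 3 := by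
    have : A ≤ A ^ 3 := le_self_pow₀ hA (by norm_num)
    linarith
  have hK : 1 ≤ max K₀ (9 * A ^ 3) := (hA.trans hA3).trans (le_max_right _ _)
  suffices H : ∀ m, ∃ e : ℝ → ℝ, (∀ x, 0 < x → 0 < e x ∧ e x ≤ 1) ∧
      MonotoneOn e (Set.Ioi 0) ∧ ∀ x, 0 < x → WeightedProducts (max K₀ (9 * A ^ 3)) (e x)
        (besselJ m x) (ladderEuler besselJ m x) (besselY m x) (ladderEuler besselY m x) by
    choose E hE using H
    exact ⟨_, E, hK, hE⟩
  intro m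
  rcases Nat.eq_zero_or_pos m with rfl | hm
  · exact ⟨fun x => min 1 x, fun x hx => ⟨lt_min one_pos hx, min_le_left _ _⟩,
      fun x _ y _ hxy => min_le_min le_rfl hxy,
      fun x hx => (h₀ x hx).mono (lt_min one_pos hx).le (le_max_left _ _)⟩
  have hm0 : (0 : ℝ) < m := by exact_mod_cast hm
  obtain ⟨e, he, hemono, hep⟩ := IsBesselPair.exists_weight_left hm0 (hJ.isBesselPair m)
    (hY.isBesselPair m)
    (by
      have h1 := continuous_besselJ m
      have h2 := continuous_besselJ (m + 1)
      unfold ladderEuler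
      fun_prop)
    (by
      obtain ⟨k, rfl⟩ : ∃ k, m = k + 1 := ⟨m - 1, by omega⟩
      rw [besselJ_succ_zero, zero_mul])
    (fun x hx => wronskian_bessel m hx) hA
    ((hA₁ m hm m le_rfl).trans a₁) ((hA₄ m hm m le_rfl).trans a₄)
  -- Since e ≤ 1, continuing it by 1 beyond the turning point preserves monotonicity.
  refine ⟨fun x => if x ≤ m then e x else 1, fun x hx => ?_, fun x hx y hy hxy => ?_,
    fun x hx => ?_⟩
  · dsimp only
    split_ifs with h
    · exact he x ⟨hx, h⟩
    · exact ⟨one_pos, le_rfl⟩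
  · dsimp only
    split_ifs with h h' h'
    · exact hemono ⟨hx, h⟩ ⟨hy, h'⟩ hxy
    · exact (he x ⟨hx, h⟩).2
    · exact absurd (hxy.trans h') h
    · exact le_rfl
  · dsimp only
    split_ifs with h
    · exact (hep x ⟨hx, h⟩).mono (he x ⟨hx, h⟩).1.le (le_max_right _ _)
    · have hx' : (m : ℝ) ≤ x := (not_le.1 h).le
      refine WeightedProducts.mono (K := A) ⟨?_, ?_, ?_, ?_⟩ zero_le_one
        (hA3.trans (le_max_right _ _))
      · rw [mul_one]; exact (hA₁ m hm x hx').trans a₁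
      · exact (hA₂ m hm x hx').trans a₂
      · exact (hA₃ m hm x hx').trans a₃
      · rw [mul_one]; exact (hA₄ m hm x hx').trans a₄

end

/-! ### Transfer of the coefficients through the layers -/

/-- Coefficients of `J_m` and `Y_m` in layer `l + 1` of the solution of the transmission problem
with coefficients `p₀` in the first layer. -/
def layerCoeff (m : ℕ) (r σ : ℕ → ℝ) (p₀ : ℝ × ℝ) (z : ℝ) : ℕ → ℝ × ℝ
  | 0 => p₀
  | l + 1 =>
    ((layerCoeff m r σ p₀ z l).1 - (σ (l + 1) / σ (l + 2) - 1) * (Real.pi / 2) *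
        ((layerCoeff m r σ p₀ z l).1 * ladderEuler besselJ m (z * r (l + 2)) +
          (layerCoeff m r σ p₀ z l).2 * ladderEuler besselY m (z * r (l + 2))) *
        besselY m (z * r (l + 2)),
      (layerCoeff m r σ p₀ z l).2 + (σ (l + 1) / σ (l + 2) - 1) * (Real.pi / 2) *
        ((layerCoeff m r σ p₀ z l).1 * ladderEuler besselJ m (z * r (l + 2)) +
          (layerCoeff m r σ p₀ z l).2 * ladderEuler besselY m (z * r (l + 2))) *
        besselJ m (z * r (l + 2)))

lemma layerCoeff_succ_value (m : ℕ) (r σ : ℕ → ℝ) (p₀ : ℝ × ℝ) (z : ℝ) (l : ℕ) :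
    (layerCoeff m r σ p₀ z (l + 1)).1 * besselJ m (z * r (l + 2)) +
      (layerCoeff m r σ p₀ z (l + 1)).2 * besselY m (z * r (l + 2)) =
    (layerCoeff m r σ p₀ z l).1 * besselJ m (z * r (l + 2)) +
      (layerCoeff m r σ p₀ z l).2 * besselY m (z * r (l + 2)) := by
  simp only [layerCoeff]
  ring

/-- The jump of the coefficients is a multiple of (-Y, J). It leaves the value unchanged and changes
the Euler derivative by a multiple of the Wronskian 2/π, which the factor π/2 normalises. -/
lemma layerCoeff_succ_euler (m : ℕ) (r σ : ℕ → ℝ) (p₀ : ℝ × ℝ) (z : ℝ) (l : ℕ)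
    (h : 0 < z * r (l + 2)) :
    (layerCoeff m r σ p₀ z (l + 1)).1 * ladderEuler besselJ m (z * r (l + 2)) +
      (layerCoeff m r σ p₀ z (l + 1)).2 * ladderEuler besselY m (z * r (l + 2)) =
    σ (l + 1) / σ (l + 2) *
      ((layerCoeff m r σ p₀ z l).1 * ladderEuler besselJ m (z * r (l + 2)) +
        (layerCoeff m r σ p₀ z l).2 * ladderEuler besselY m (z * r (l + 2))) := by
  have hW := wronskian_bessel m h
  have hpi : Real.pi / 2 * (2 / Real.pi) = 1 := by field_simp
  simp only [layerCoeff]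
  generalize layerCoeff m r σ p₀ z l = p at *
  linear_combination (σ (l + 1) / σ (l + 2) - 1) * (Real.pi / 2) *
    (p.1 * ladderEuler besselJ m (z * r (l + 2)) + p.2 * ladderEuler besselY m (z * r (l + 2))) * hW
    + (σ (l + 1) / σ (l + 2) - 1) *
    (p.1 * ladderEuler besselJ m (z * r (l + 2)) + p.2 * ladderEuler besselY m (z * r (l + 2))) * hpi

/-- One transfer step, with weights. -/
lemma transfer_step {K e j dj y dy a b s η Q : ℝ} (he : 0 < e)
    (h : WeightedProducts K e j dj y dy) (hη : |s - 1| ≤ η) (ha : |a| ≤ Q) (hb : |b| ≤ Q * e) :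
    |(s - 1) * (Real.pi / 2) * (a * dj + b * dy) * y| ≤ η * (4 * K * Q) ∧
    |(s - 1) * (Real.pi / 2) * (a * dj + b * dy) * j| ≤ η * (4 * K * Q * e) := by
  have hQ : 0 ≤ Q := (abs_nonneg a).trans ha
  have hη0 : 0 ≤ η := (abs_nonneg _).trans hη
  have hpi : |Real.pi / 2| ≤ 2 := by
    rw [abs_of_pos (by positivity)]; linarith [Real.pi_lt_four]
  have h1 : |a * (y * dj) + b * (y * dy)| ≤ 2 * K * Q := by
    have e1 : |a * (y * dj)| ≤ Q * K := by
      rw [abs_mul]; exact mul_le_mul ha h.snd_fst (abs_nonneg _) hQ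
    have e2 : |b * (y * dy)| ≤ Q * K := by
      rw [abs_mul]
      calc |b| * |y * dy| ≤ Q * e * |y * dy| := by gcongr
        _ = Q * (|y * dy| * e) := by ring
        _ ≤ Q * K := by gcongr; exact h.snd_snd
    linarith [abs_add_le (a * (y * dj)) (b * (y * dy))]
  have h2 : |a * (j * dj) + b * (j * dy)| ≤ 2 * K * Q * e := by
    have e1 : |a * (j * dj)| ≤ Q * (K * e) := by
      rw [abs_mul]; exact mul_le_mul ha h.fst_fst (abs_nonneg _) hQ
    have e2 : |b * (j * dy)| ≤ Q * e * K := by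
      rw [abs_mul]; exact mul_le_mul hb h.fst_snd (abs_nonneg _) (by positivity)
    linarith [abs_add_le (a * (j * dj)) (b * (j * dy))]
  constructor
  · rw [show (s - 1) * (Real.pi / 2) * (a * dj + b * dy) * y
      = (s - 1) * ((Real.pi / 2) * (a * (y * dj) + b * (y * dy))) by ring, abs_mul, abs_mul]
    calc |s - 1| * (|Real.pi / 2| * |a * (y * dj) + b * (y * dy)|)
        ≤ η * (2 * (2 * K * Q)) := by gcongr
      _ = η * (4 * K * Q) := by ring
  · rw [show (s - 1) * (Real.pi / 2) * (a * dj + b * dy) * j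
      = (s - 1) * ((Real.pi / 2) * (a * (j * dj) + b * (j * dy))) by ring, abs_mul, abs_mul]
    calc |s - 1| * (|Real.pi / 2| * |a * (j * dj) + b * (j * dy)|)
        ≤ η * (2 * (2 * K * Q * e)) := by gcongr
      _ = η * (4 * K * Q * e) := by ring

/-- The bound on the second coefficient is relative to E at the next interface, which only relaxes
as E increases. Each step costs the factor 1 + 3 · 4K, from the crude ratio bound 3; the finer bound
η enters the deviation linearly, and its increments sum to the same geometric factor. -/
lemma layerCoeff_bounds {m N : ℕ} {r σ : ℕ → ℝ} {p₀ : ℝ × ℝ} {z K η M : ℝ} {E : ℝ → ℝ}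
    (hK : 1 ≤ K) (hE : ∀ x, 0 < x → 0 < E x ∧ E x ≤ 1) (hEm : MonotoneOn E (Set.Ioi 0))
    (hEp : ∀ x, 0 < x → WeightedProducts K (E x) (besselJ m x) (ladderEuler besselJ m x)
        (besselY m x) (ladderEuler besselY m x))
    (hz : 0 < z) (hr : ∀ l, l + 1 ≤ N → 0 < r (l + 2))
    (hrm : ∀ l, l + 2 ≤ N → r (l + 2) ≤ r (l + 3))
    (hη : ∀ l, l + 2 ≤ N → |σ (l + 1) / σ (l + 2) - 1| ≤ η)
    (h3 : ∀ l, l + 2 ≤ N → |σ (l + 1) / σ (l + 2) - 1| ≤ 3)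
    (hp₁ : |p₀.1| ≤ M) (hp₂ : |p₀.2| ≤ M * E (z * r 2)) (hη0 : 0 ≤ η) {l : ℕ} (hl : l + 1 ≤ N) :
    (|(layerCoeff m r σ p₀ z l).1| ≤ (1 + 12 * K) ^ l * M ∧
      |(layerCoeff m r σ p₀ z l).2| ≤ (1 + 12 * K) ^ l * M * E (z * r (l + 2))) ∧
    |(layerCoeff m r σ p₀ z l).1 - p₀.1| ≤ η * ((1 + 12 * K) ^ l * M) ∧
    |(layerCoeff m r σ p₀ z l).2 - p₀.2| ≤ η * ((1 + 12 * K) ^ l * M) := by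
  have hM : 0 ≤ M := (abs_nonneg _).trans hp₁
  induction l with
  | zero =>
    refine ⟨⟨by simpa [layerCoeff] using hp₁, by simpa [layerCoeff] using hp₂⟩, ?_, ?_⟩ <;>
    · simp [layerCoeff]; positivity
  | succ l ih =>
    obtain ⟨⟨i₁, i₂⟩, i₃, i₄⟩ := ih (by omega)
    have hρ : 0 < z * r (l + 2) := mul_pos hz (hr l (by omega))
    have hρ' : z * r (l + 2) ≤ z * r (l + 3) := by
      have := hrm l hl
      gcongr
    obtain ⟨he0, he1⟩ := hE _ hρ
    have hee : E (z * r (l + 2)) ≤ E (z * r (l + 3)) := hEm hρ (hρ.trans_le hρ') hρ'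
    obtain ⟨s₁, s₂⟩ := transfer_step he0 (hEp _ hρ) (h3 l hl) i₁ i₂
    obtain ⟨t₁, t₂⟩ := transfer_step he0 (hEp _ hρ) (hη l hl) i₁ i₂
    set Q := (1 + 12 * K) ^ l * M with hQ
    have hQ0 : 0 ≤ Q := by positivity
    rw [show (1 + 12 * K) ^ (l + 1) * M = (1 + 12 * K) * Q by rw [hQ]; ring]
    have hKQ : 0 ≤ K * Q := by positivity
    refine ⟨⟨?_, ?_⟩, ?_, ?_⟩ <;> simp only [layerCoeff]
    · refine (abs_sub _ _).trans ?_
      linarith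
    · refine (abs_add_le _ _).trans ?_
      calc _ ≤ Q * E (z * r (l + 2)) + 3 * (4 * K * Q * E (z * r (l + 2))) := add_le_add i₂ s₂
        _ = (1 + 12 * K) * Q * E (z * r (l + 2)) := by ring
        _ ≤ (1 + 12 * K) * Q * E (z * r (l + 1 + 2)) := by gcongr
    · rw [sub_right_comm]
      refine (abs_sub _ _).trans ?_
      have : 0 ≤ η * (K * Q) := by positivity
      linarith
    · rw [add_sub_right_comm]
      refine (abs_add_le _ _).trans ?_
      have h5 : η * (4 * K * Q * E (z * r (l + 2))) ≤ η * (4 * K * Q * 1) := by gcongr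
      have : 0 ≤ η * (K * Q) := by positivity
      linarith

lemma continuousOn_layerCoeff {m N : ℕ} {r σ : ℕ → ℝ} {p₀ : ℝ × ℝ}
    (hr : ∀ l, l + 1 ≤ N → 0 < r (l + 2)) {l : ℕ} (hl : l + 1 ≤ N) :
    ContinuousOn (fun z => (layerCoeff m r σ p₀ z l).1) (Set.Ioi 0) ∧
      ContinuousOn (fun z => (layerCoeff m r σ p₀ z l).2) (Set.Ioi 0) := by
  induction l with
  | zero => simp only [layerCoeff]; exact ⟨continuousOn_const, continuousOn_const⟩
  | succ l ih =>
    obtain ⟨c₁, c₂⟩ := ih (by omega)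
    have hmaps : Set.MapsTo (fun z => z * r (l + 2)) (Set.Ioi 0) (Set.Ioi 0) := fun z hz =>
      mul_pos hz (hr l (by omega))
    have hid : ContinuousOn (fun z : ℝ => z * r (l + 2)) (Set.Ioi 0) := by fun_prop
    have hcomp : ∀ {f g : ℝ → ℝ}, (∀ x, 0 < x → HasDerivAt f (g x) x) →
        ContinuousOn (fun z => f (z * r (l + 2))) (Set.Ioi 0) := fun hf =>
      ContinuousOn.comp (fun x hx => (hf x hx).continuousAt.continuousWithinAt) hid hmaps
    have h1 := hcomp (isBesselLadder_besselJ.isBesselPair m).hasDerivAt_fst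
    have h2 := hcomp (isBesselLadder_besselJ.isBesselPair m).hasDerivAt_snd
    have h3 := hcomp (isBesselLadder_besselY.isBesselPair m).hasDerivAt_fst
    have h4 := hcomp (isBesselLadder_besselY.isBesselPair m).hasDerivAt_snd
    have h5 := (c₁.mul h2).add (c₂.mul h4)
    have h6 := continuousOn_const.mul h5
      (f := fun _ => (σ (l + 1) / σ (l + 2) - 1) * (Real.pi / 2))
    exact ⟨c₁.sub (h6.mul h3), c₂.add (h6.mul h1)⟩

/-! ### The determinant of the transmission matrices -/

/-- Induction splitting off the last 2×2 diagonal block, above which the entries vanish. -/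
lemma det_of_block_lowerTriangular (g : ℕ → ℕ → ℝ) (k : ℕ)
    (hg : ∀ l < k, ∀ i j, i < 2 * l → 2 * l ≤ j → g i j = 0) :
    (Matrix.of fun i j : Fin (2 * k) => g i j).det = ∏ l ∈ Finset.range k,
      (g (2 * l) (2 * l) * g (2 * l + 1) (2 * l + 1) - g (2 * l) (2 * l + 1) * g (2 * l + 1) (2 * l)) := by
  induction k with
  | zero => simp
  | succ k ih =>
    rw [Finset.prod_range_succ, ← ih fun l hl => hg l (by omega)]
    rw [← Matrix.det_submatrix_equiv_self (finSumFinEquiv : Fin (2 * k) ⊕ Fin 2 ≃ Fin (2 * k + 2))]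
    have : ((Matrix.of fun i j : Fin (2 * (k + 1)) => g i j).submatrix
        (finSumFinEquiv : Fin (2 * k) ⊕ Fin 2 ≃ Fin (2 * k + 2)) finSumFinEquiv) =
        Matrix.fromBlocks (Matrix.of fun i j : Fin (2 * k) => g i j) 0
          (Matrix.of fun (i : Fin 2) (j : Fin (2 * k)) => g (2 * k + i) j)
          (Matrix.of fun i j : Fin 2 => g (2 * k + i) (2 * k + j)) := by
      ext (i | i) (j | j)
      · simp
      · simpa using hg k (by omega) i (2 * k + j) i.2 (by omega)
      · simp
      · simp
    rw [this, Matrix.det_fromBlocks_zero₁₂, Matrix.det_fin_two]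
    simp

/-- As v₀ = 1, replacing the first column by A v = β e_last preserves the determinant. Expanding
along that column gives the sign (-1)^(2k) = 1 and a block lower triangular minor, with columns
shifted by one. -/
lemma det_of_block_hessenberg (g : ℕ → ℕ → ℝ) (k : ℕ) (v : ℕ → ℝ) (β : ℝ) (hv : v 0 = 1)
    (h0 : ∀ i < 2 * k, ∑ j ∈ Finset.range (2 * k + 1), g i j * v j = 0)
    (hlast : ∑ j ∈ Finset.range (2 * k + 1), g (2 * k) j * v j = β)
    (hg : ∀ l < k, ∀ i j, i < 2 * l → 2 * l ≤ j → g i (j + 1) = 0) :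
    (Matrix.of fun i j : Fin (2 * k + 1) => g i j).det = β * ∏ l ∈ Finset.range k,
      (g (2 * l) (2 * l + 1) * g (2 * l + 1) (2 * l + 2)
        - g (2 * l) (2 * l + 2) * g (2 * l + 1) (2 * l + 1)) := by
  set A : Matrix (Fin (2 * k + 1)) (Fin (2 * k + 1)) ℝ := Matrix.of fun i j => g i j with hA
  have hAv : A.mulVec (fun j => v j) = Pi.single (Fin.last (2 * k)) β := by
    ext i
    have hsum : A.mulVec (fun j => v j) i = ∑ j ∈ Finset.range (2 * k + 1), g i j * v j := by
      rw [← Fin.sum_univ_eq_sum_range (fun j => g i j * v j)]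
      rfl
    rw [hsum]
    rcases eq_or_ne i (Fin.last (2 * k)) with rfl | hi
    · simpa using hlast
    · rw [Pi.single_eq_of_ne hi]
      exact h0 i (Fin.val_lt_last hi)
  have hcr : A.det = (A.updateCol 0 (Pi.single (Fin.last (2 * k)) β)).det := by
    rw [← Matrix.cramer_apply, ← hAv, Matrix.cramer_eq_adjugate_mulVec, Matrix.mulVec_mulVec,
      Matrix.adjugate_mul]
    simp [Matrix.smul_mulVec, hv]
  rw [hcr, Matrix.det_succ_column_zero, Finset.sum_eq_single (Fin.last (2 * k))]
  · rw [← det_of_block_lowerTriangular (fun i j => g i (j + 1)) k hg]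
    simp only [Fin.val_last, pow_mul, Matrix.updateCol_self, Pi.single_eq_same]
    norm_num
    left
    congr 1
  · intro i _ hi
    simp [hi]
  · simp

/-- Groups the columns by layer: the first layer owns one column, every later layer two. -/
lemma sum_range_odd (F : ℕ → ℝ) (k : ℕ) :
    ∑ j ∈ Finset.range (2 * k + 1), F j = ∑ i ∈ Finset.range (k + 1),
      if i = 0 then F 0 else F (2 * i - 1) + F (2 * i) := by
  induction k with
  | zero => simp
  | succ k ih =>
    rw [Finset.sum_range_succ _ (k + 1), ← ih, show 2 * (k + 1) + 1 = 2 * k + 1 + 1 + 1 by ring,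
      Finset.sum_range_succ, Finset.sum_range_succ, if_neg (by omega), add_assoc]
    congr 2

lemma prod_Icc_two_eq (f : ℕ → ℝ) (k : ℕ) :
    ∏ l ∈ Finset.Icc 2 (k + 1), f l = ∏ l ∈ Finset.range k, f (l + 2) := by
  induction k with
  | zero => simp
  | succ k ih => rw [Finset.prod_Icc_succ_top (by omega), ih, Finset.prod_range_succ]

lemma columnFun_zero (m : ℕ) (first : ℝ → ℝ) : columnFun m first 0 = first := by simp [columnFun]

lemma columnFun_odd (m : ℕ) (first : ℝ → ℝ) (i : ℕ) :
    columnFun m first (2 * i + 1) = besselJ m := by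
  rw [columnFun, if_neg (by omega), if_pos (by omega)]

lemma columnFun_even (m : ℕ) (first : ℝ → ℝ) (i : ℕ) :
    columnFun m first (2 * i + 2) = besselY m := by
  rw [columnFun, if_neg (by omega), if_neg (by omega)]

lemma columnLayer_zero : columnLayer 0 = 1 := rfl

lemma columnLayer_odd (i : ℕ) : columnLayer (2 * i + 1) = i + 2 := by
  unfold columnLayer; omega

lemma columnLayer_even (i : ℕ) : columnLayer (2 * i + 2) = i + 2 := by
  unfold columnLayer; omega

/-- The entries of the transmission matrix for `k + 1` layers, with natural number indices. -/
def transmissionEntry (m k : ℕ) (r σ : ℕ → ℝ) (first : ℝ → ℝ) (bc : (ℝ → ℝ) → ℝ → ℝ) (z : ℝ)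
    (i j : ℕ) : ℝ :=
  if i = 2 * k then
    if columnLayer j = k + 1 then bc (columnFun m first j) (z * r (k + 2)) else 0
  else if i % 2 = 0 then
    if columnLayer j = i / 2 + 1 then columnFun m first j (z * r (i / 2 + 2))
    else if columnLayer j = i / 2 + 2 then -columnFun m first j (z * r (i / 2 + 2))
    else 0
  else
    if columnLayer j = i / 2 + 1 then
      σ (i / 2 + 1) / σ (i / 2 + 2) * deriv (columnFun m first j) (z * r (i / 2 + 2))
    else if columnLayer j = i / 2 + 2 then -deriv (columnFun m first j) (z * r (i / 2 + 2))
    else 0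

lemma transmissionMatrix_eq (m k : ℕ) (r σ : ℕ → ℝ) (first : ℝ → ℝ) (bc : (ℝ → ℝ) → ℝ → ℝ)
    (z : ℝ) : transmissionMatrix m (k + 1) r σ first bc z =
      Matrix.of fun i j : Fin (2 * k + 1) => transmissionEntry m k r σ first bc z i j := rfl

section Entries

variable (m k : ℕ) (r σ : ℕ → ℝ) (first : ℝ → ℝ) (bc : (ℝ → ℝ) → ℝ → ℝ) (z : ℝ)

lemma transmissionEntry_last (j : ℕ) : transmissionEntry m k r σ first bc z (2 * k) j =
    if columnLayer j = k + 1 then bc (columnFun m first j) (z * r (k + 2)) else 0 := by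
  rw [transmissionEntry, if_pos rfl]

lemma transmissionEntry_even {l : ℕ} (hl : l < k) (j : ℕ) :
    transmissionEntry m k r σ first bc z (2 * l) j =
    if columnLayer j = l + 1 then columnFun m first j (z * r (l + 2))
    else if columnLayer j = l + 2 then -columnFun m first j (z * r (l + 2)) else 0 := by
  rw [transmissionEntry, if_neg (by omega), if_pos (by omega), Nat.mul_div_cancel_left l two_pos]

lemma transmissionEntry_odd (l j : ℕ) :
    transmissionEntry m k r σ first bc z (2 * l + 1) j =
    if columnLayer j = l + 1 then
      σ (l + 1) / σ (l + 2) * deriv (columnFun m first j) (z * r (l + 2))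
    else if columnLayer j = l + 2 then -deriv (columnFun m first j) (z * r (l + 2)) else 0 := by
  rw [transmissionEntry, if_neg (by omega), if_neg (by omega),
    show (2 * l + 1) / 2 = l by omega]

end Entries

/-- The vector of coefficients, in the order of the columns, built from the pairs of all layers. -/
def coeffVector (p : ℕ → ℝ × ℝ) (j : ℕ) : ℝ :=
  if j = 0 then 1 else if j % 2 = 1 then (p ((j + 1) / 2)).1 else (p (j / 2)).2

lemma coeffVector_odd (p : ℕ → ℝ × ℝ) (i : ℕ) : coeffVector p (2 * i + 1) = (p (i + 1)).1 := by
  rw [coeffVector, if_neg (by omega), if_pos (by omega), show (2 * i + 1 + 1) / 2 = i + 1 by omega]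

lemma coeffVector_even (p : ℕ → ℝ × ℝ) (i : ℕ) : coeffVector p (2 * i + 2) = (p (i + 1)).2 := by
  rw [coeffVector, if_neg (by omega), if_neg (by omega), show (2 * i + 2) / 2 = i + 1 by omega]

/-- A row whose entries in the columns of layer `l + 1` are given by a functional `ψ` of the column
function, and those of layer `l + 2` by a functional `χ`, applied to the coefficient vector. -/
lemma sum_row_mul_coeffVector {m k l : ℕ} {first : ℝ → ℝ} {p : ℕ → ℝ × ℝ} {g : ℕ → ℝ}
    (ψ χ : (ℝ → ℝ) → ℝ) (hl : l < k)
    (hg : ∀ j, g j = if columnLayer j = l + 1 then ψ (columnFun m first j)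
      else if columnLayer j = l + 2 then χ (columnFun m first j) else 0)
    (hfirst : l = 0 → ψ first = (p 0).1 * ψ (besselJ m) + (p 0).2 * ψ (besselY m)) :
    ∑ j ∈ Finset.range (2 * k + 1), g j * coeffVector p j =
      ((p l).1 * ψ (besselJ m) + (p l).2 * ψ (besselY m)) +
      ((p (l + 1)).1 * χ (besselJ m) + (p (l + 1)).2 * χ (besselY m)) := by
  have hodd : ∀ i, g (2 * i + 1) * coeffVector p (2 * i + 1) =
      (if i + 1 = l then ψ (besselJ m) else if i = l then χ (besselJ m) else 0) * (p (i + 1)).1 := by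
    intro i
    rw [hg, coeffVector_odd, columnLayer_odd, columnFun_odd]
    congr 1
    simp only [Nat.add_right_cancel_iff, show i + 2 = l + 1 ↔ i + 1 = l by omega]
  have heven : ∀ i, g (2 * i + 2) * coeffVector p (2 * i + 2) =
      (if i + 1 = l then ψ (besselY m) else if i = l then χ (besselY m) else 0) * (p (i + 1)).2 := by
    intro i
    rw [hg, coeffVector_even, columnLayer_even, columnFun_even]
    congr 1
    simp only [Nat.add_right_cancel_iff, show i + 2 = l + 1 ↔ i + 1 = l by omega]
  have hzero : g 0 * coeffVector p 0 = if l = 0 then ψ first else 0 := by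
    rw [hg, columnLayer_zero, columnFun_zero]
    rcases Nat.eq_zero_or_pos l with rfl | h
    · simp [coeffVector]
    · rw [if_neg (by omega), if_neg (by omega), if_neg (by omega), zero_mul]
  rw [sum_range_odd, Finset.sum_eq_add l (l + 1) (by omega)]
  · congr 1
    · rcases l with _ | l
      · rw [if_pos rfl, hzero, if_pos rfl, hfirst rfl]
      · rw [if_neg (by omega), show 2 * (l + 1) - 1 = 2 * l + 1 by omega,
          show 2 * (l + 1) = 2 * l + 2 by ring, hodd, heven, if_pos rfl, if_pos rfl]
        ring
    · rw [if_neg (by omega), show 2 * (l + 1) - 1 = 2 * l + 1 by omega,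
        show 2 * (l + 1) = 2 * l + 2 by ring, hodd, heven, if_neg (show ¬ l + 1 = l by omega),
        if_neg (show ¬ l + 1 = l by omega), if_pos rfl, if_pos rfl]
      ring
  · rintro i - ⟨h1, h2⟩
    rcases i with _ | i
    · rw [if_pos rfl, hzero, if_neg (by omega)]
    · rw [if_neg (by omega), show 2 * (i + 1) - 1 = 2 * i + 1 by omega,
        show 2 * (i + 1) = 2 * i + 2 by ring, hodd, heven, if_neg (by omega), if_neg (by omega),
        if_neg (by omega), if_neg (by omega)]
      ring
  · intro h
    exact absurd (Finset.mem_range.2 (by omega)) h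
  · intro h
    exact absurd (Finset.mem_range.2 (by omega)) h

lemma deriv_besselJ_eq (m : ℕ) {x : ℝ} (hx : 0 < x) :
    deriv (besselJ m) x = ladderEuler besselJ m x / x :=
  ((isBesselLadder_besselJ.isBesselPair m).hasDerivAt_fst x hx).deriv

lemma deriv_besselY_eq (m : ℕ) {x : ℝ} (hx : 0 < x) :
    deriv (besselY m) x = ladderEuler besselY m x / x :=
  ((isBesselLadder_besselY.isBesselPair m).hasDerivAt_fst x hx).deriv

/-- The normalised determinant of a transmission matrix is the boundary value of the solution of
the transmission problem that equals `first` in the first layer. -/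
theorem prod_mul_det_transmissionMatrix {m k : ℕ} (hk : 1 ≤ k) {r σ : ℕ → ℝ} {first : ℝ → ℝ}
    (bc : (ℝ → ℝ) → ℝ → ℝ) {z : ℝ} (hz : 0 < z) (hr : ∀ l < k, 0 < r (l + 2)) {p₀ : ℝ × ℝ}
    (hf : first (z * r 2) = p₀.1 * besselJ m (z * r 2) + p₀.2 * besselY m (z * r 2))
    (hf' : deriv first (z * r 2) =
      p₀.1 * deriv (besselJ m) (z * r 2) + p₀.2 * deriv (besselY m) (z * r 2)) :
    (∏ l ∈ Finset.Icc 2 (k + 1), (Real.pi * z * r l / 2)) *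
        (transmissionMatrix m (k + 1) r σ first bc z).det =
      (layerCoeff m r σ p₀ z k).1 * bc (besselJ m) (z * r (k + 2)) +
        (layerCoeff m r σ p₀ z k).2 * bc (besselY m) (z * r (k + 2)) := by
  set p := layerCoeff m r σ p₀ z with hp
  have hρ : ∀ l < k, 0 < z * r (l + 2) := fun l hl => mul_pos hz (hr l hl)
  rw [transmissionMatrix_eq]
  erw [det_of_block_hessenberg (transmissionEntry m k r σ first bc z) k (coeffVector p)
    ((p k).1 * bc (besselJ m) (z * r (k + 2)) + (p k).2 * bc (besselY m) (z * r (k + 2)))]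
  · rw [prod_Icc_two_eq, mul_left_comm, ← Finset.prod_mul_distrib, Finset.prod_eq_one, mul_one]
    intro l hl
    have hl' := Finset.mem_range.1 hl
    rw [transmissionEntry_even _ _ _ _ _ _ _ hl', transmissionEntry_even _ _ _ _ _ _ _ hl',
      transmissionEntry_odd, transmissionEntry_odd,
      columnLayer_odd, columnLayer_even, columnFun_odd, columnFun_even]
    simp only [Nat.add_left_cancel_iff, OfNat.ofNat_ne_one, if_false, if_true]
    rw [deriv_besselJ_eq m (hρ l hl'), deriv_besselY_eq m (hρ l hl')]
    have hW := wronskian_bessel m (hρ l hl')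
    have h1 := (hρ l hl').ne'
    have h2 : Real.pi * z * r (l + 2) / 2 * (-besselJ m (z * r (l + 2)) *
        -(ladderEuler besselY m (z * r (l + 2)) / (z * r (l + 2))) - -besselY m (z * r (l + 2)) *
        -(ladderEuler besselJ m (z * r (l + 2)) / (z * r (l + 2)))) =
        Real.pi / 2 * (besselJ m (z * r (l + 2)) * ladderEuler besselY m (z * r (l + 2)) -
          besselY m (z * r (l + 2)) * ladderEuler besselJ m (z * r (l + 2))) := by
      have := hz.ne'
      have := (hr l hl').ne'
      field_simp
    rw [h2, hW]
    field_simp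
  · simp [coeffVector]
  · intro i hi
    obtain ⟨l, rfl | rfl⟩ : ∃ l, i = 2 * l ∨ i = 2 * l + 1 := ⟨i / 2, by omega⟩
    · have hl : l < k := by omega
      rw [sum_row_mul_coeffVector (fun φ => φ (z * r (l + 2))) (fun φ => -φ (z * r (l + 2))) hl
        (transmissionEntry_even m k r σ first bc z hl) (by rintro rfl; exact hf)]
      linear_combination -layerCoeff_succ_value m r σ p₀ z l
    · have hl : l < k := by omega
      rw [sum_row_mul_coeffVector (fun φ => σ (l + 1) / σ (l + 2) * deriv φ (z * r (l + 2)))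
        (fun φ => -deriv φ (z * r (l + 2))) hl
        (transmissionEntry_odd m k r σ first bc z l) (by
          rintro rfl
          simp only [zero_add]
          rw [hf', show (p 0) = p₀ from rfl]
          ring)]
      rw [deriv_besselJ_eq m (hρ l hl), deriv_besselY_eq m (hρ l hl)]
      linear_combination -(1 / (z * r (l + 2))) * layerCoeff_succ_euler m r σ p₀ z l (hρ l hl)
  -- The boundary row is treated as a row between the last two layers whose inner functional is
  -- zero.
  · obtain ⟨k, rfl⟩ : ∃ n, k = n + 1 := ⟨k - 1, by omega⟩
    rw [sum_row_mul_coeffVector (l := k) (m := m) (first := first) (fun _ => 0)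
      (fun φ => bc φ (z * r (k + 1 + 2))) (by omega) _ (by simp)]
    · ring
    · intro j
      rw [transmissionEntry_last]
      by_cases h : columnLayer j = k + 1
      · rw [if_neg (by omega), if_pos h]
      · rw [if_neg h]
  · intro l hl i j hi hj
    have h1 : l + 2 ≤ columnLayer (j + 1) := by unfold columnLayer; omega
    have h2 : ¬ columnLayer (j + 1) = i / 2 + 1 := by omega
    have h3 : ¬ columnLayer (j + 1) = i / 2 + 2 := by omega
    rw [transmissionEntry, if_neg (by omega : ¬ i = 2 * k)]
    simp only [if_neg h2, if_neg h3, ite_self]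

section

open MeasureTheory

/-! ### The deviation of the material parameters -/

lemma radii_mono {N : ℕ} {r : ℕ → ℝ} (hr : ∀ l ∈ Finset.Icc 1 N, r l < r (l + 1)) {i j : ℕ}
    (hi : 1 ≤ i) (hij : i ≤ j) (hj : j ≤ N + 1) : r i ≤ r j := by
  induction j, hij using Nat.le_induction with
  | base => exact le_rfl
  | succ j hij ih =>
    exact (ih (by omega)).trans (hr j (Finset.mem_Icc.2 ⟨by omega, by omega⟩)).le

lemma stepProfile_eq {N : ℕ} {r σ : ℕ → ℝ} (hr : ∀ l ∈ Finset.Icc 1 N, r l < r (l + 1)) {l : ℕ}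
    (hl : l ∈ Finset.Icc 1 N) {t : ℝ} (ht : t ∈ Set.Ioo (r l) (r (l + 1))) :
    stepProfile N r σ t = σ l := by
  rw [stepProfile, Finset.sum_eq_single_of_mem l hl, Set.indicator_of_mem ht]
  intro i hi hne
  rw [Set.indicator_of_notMem]
  intro hti
  rw [Finset.mem_Icc] at hl hi
  rcases lt_or_gt_of_ne hne with h | h
  · have := radii_mono hr (i := i + 1) (j := l) (by omega) (by omega) (by omega)
    linarith [hti.2, ht.1]
  · have := radii_mono hr (i := l + 1) (j := i) (by omega) (by omega) (by omega)
    linarith [hti.1, ht.2]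

/-- The l-th annulus is a nonempty open subset of the disk, hence of positive measure, so the
essential supremum sees the value σ l. -/
lemma abs_sub_le_stepDeviation {N : ℕ} {r : ℕ → ℝ} (hr_first : r 1 = 0) (hr_last : r (N + 1) = 1)
    (hr : ∀ l ∈ Finset.Icc 1 N, r l < r (l + 1)) (σ₀ : ℝ) (σ : ℕ → ℝ) {l : ℕ}
    (hl : l ∈ Finset.Icc 1 N) : |σ₀ - σ l| ≤ stepDeviation N r σ₀ σ := by
  set f : EuclideanSpace ℝ (Fin 2) → ℝ := fun x => σ₀ - stepProfile N r σ ‖x‖ with hf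
  have hl' := Finset.mem_Icc.1 hl
  have hbound : ∀ x, ‖f x‖ ≤ |σ₀| + ∑ i ∈ Finset.Icc 1 N, |σ i| := by
    intro x
    rw [Real.norm_eq_abs]
    refine (abs_sub _ _).trans (add_le_add le_rfl ((Finset.abs_sum_le_sum_abs _ _).trans
      (Finset.sum_le_sum fun i _ => ?_)))
    by_cases h : ‖x‖ ∈ Set.Ioo (r i) (r (i + 1))
    · rw [Set.indicator_of_mem h]
    · rw [Set.indicator_of_notMem h, abs_zero]; exact abs_nonneg _
  -- Finiteness matters: `toReal` would send an infinite norm to 0.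
  have hfin : eLpNorm f ⊤ (volume.restrict crossSection) < ⊤ := by
    rw [eLpNorm_exponent_top]
    exact eLpNormEssSup_lt_top_of_ae_bound (Filter.Eventually.of_forall hbound)
  have hae : ∀ᵐ x ∂(volume : Measure (EuclideanSpace ℝ (Fin 2))), x ∈ crossSection →
      ‖f x‖ₑ ≤ eLpNorm f ⊤ (volume.restrict crossSection) := by
    rw [← ae_restrict_iff' (by exact Metric.isOpen_ball.measurableSet), eLpNorm_exponent_top]
    exact ae_le_eLpNormEssSup
  set S : Set (EuclideanSpace ℝ (Fin 2)) := (fun x => ‖x‖) ⁻¹' Set.Ioo (r l) (r (l + 1)) with hS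
  have hSo : IsOpen S := isOpen_Ioo.preimage continuous_norm
  have hrl : 0 ≤ r l := hr_first ▸ radii_mono hr le_rfl hl'.1 (by omega)
  have hlt := hr l hl
  obtain ⟨x₀, hx₀⟩ := exists_norm_eq (EuclideanSpace ℝ (Fin 2))
    (by linarith : 0 ≤ (r l + r (l + 1)) / 2)
  have hSne : S.Nonempty := ⟨x₀, by
    simp only [hS, Set.mem_preimage, hx₀, Set.mem_Ioo]; constructor <;> linarith⟩
  obtain ⟨x, hxS, hx⟩ : ∃ x ∈ S, x ∈ crossSection →
      ‖f x‖ₑ ≤ eLpNorm f ⊤ (volume.restrict crossSection) := by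
    by_contra h
    push Not at h
    have h0 : volume S = 0 := measure_mono_null (fun x hx => by
      have := h x hx
      simpa using this) hae
    exact (hSo.measure_pos volume hSne).ne' h0
  have hxc : x ∈ crossSection := by
    have h1 : r (l + 1) ≤ 1 := hr_last ▸ radii_mono hr (by omega) (by omega) le_rfl
    simpa [crossSection] using hxS.2.trans_le h1
  have hfx : f x = σ₀ - σ l := by
    simp only [hf, stepProfile_eq hr hl hxS]
  have := ENNReal.toReal_mono hfin.ne (hx hxc)
  rwa [hfx, toReal_enorm, Real.norm_eq_abs] at this

lemma stepDeviation_nonneg (N : ℕ) (r : ℕ → ℝ) (σ₀ : ℝ) (σ : ℕ → ℝ) :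
    0 ≤ stepDeviation N r σ₀ σ := ENNReal.toReal_nonneg

lemma abs_ratio_sub_one_le {σ₀ a b δ : ℝ} (hσ₀ : 0 < σ₀) (ha : σ₀ / 2 ≤ a ∧ a ≤ 2 * σ₀)
    (hb : σ₀ / 2 ≤ b ∧ b ≤ 2 * σ₀) (hδa : |σ₀ - a| ≤ δ) (hδb : |σ₀ - b| ≤ δ) :
    |a / b - 1| ≤ 4 / σ₀ * δ ∧ |a / b - 1| ≤ 3 := by
  have hb0 : 0 < b := by linarith [hb.1]
  have hδ : 0 ≤ δ := (abs_nonneg _).trans hδa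
  have h1 : a / b - 1 = (a - b) / b := by field_simp
  rw [h1, abs_div, abs_of_pos hb0]
  constructor
  · rw [div_le_iff₀ hb0]
    have h2 : |a - b| ≤ 2 * δ := by
      rw [abs_le] at *
      constructor <;> linarith [hδa.1, hδa.2, hδb.1, hδb.2]
    calc |a - b| ≤ 2 * δ := h2
      _ = 4 / σ₀ * δ * (σ₀ / 2) := by field_simp; ring
      _ ≤ 4 / σ₀ * δ * b := by gcongr; exact hb.1
  · rw [div_le_iff₀ hb0, abs_le]
    constructor <;> linarith [ha.1, ha.2, hb.1, hb.2]

/-! ### Perturbation of a single transmission problem -/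

/-- The perturbation estimate for one choice `bc` of the boundary operator. -/
lemma transmission_estimate {N : ℕ} (hN : 2 ≤ N) {r : ℕ → ℝ} (hr_first : r 1 = 0)
    (hr_last : r (N + 1) = 1) (hr : ∀ l ∈ Finset.Icc 1 N, r l < r (l + 1)) {σ₀ : ℝ} (hσ₀ : 0 < σ₀)
    (bc : (ℝ → ℝ) → ℝ → ℝ)
    (hbcJ : ∀ m, ContinuousOn (bc (besselJ m)) (Set.Ioi 0))
    (hbcY : ∀ m, ContinuousOn (bc (besselY m)) (Set.Ioi 0)) :
    ∃ C : ℝ, 0 < C ∧ ∀ σ : ℕ → ℝ, (∀ l ∈ Finset.Icc 1 N, σ₀ / 2 ≤ σ l ∧ σ l ≤ 2 * σ₀) →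
      ∃ f : ℕ → ℝ → ℝ, (∀ m, ContinuousOn (f m) (Set.Ioi 0)) ∧
        ∀ q ∈ Set.Icc (r 2 / r (N + 1) * r 2) (r 2), ∀ z : ℝ, 0 < z → ∀ m : ℕ,
          (∏ l ∈ Finset.Icc 2 N, (Real.pi * z * r l / 2)) *
              (transmissionMatrix m N r σ (besselJ m) bc z).det
            = bc (besselJ m) (z * r (N + 1)) + f m z ∧
          |f m z| ≤ C * stepDeviation N r σ₀ σ * max |bc (besselJ m) z| |bc (besselY m) z| ∧
          |z ^ N * besselJ m (z * q) * deriv (besselJ m) (z * q) *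
              (transmissionMatrix m N r σ (besselY m) bc z).det|
            ≤ C * max |bc (besselJ m) z| |bc (besselY m) z| := by
  obtain ⟨k, rfl⟩ : ∃ k, N = k + 1 := ⟨N - 1, by omega⟩
  have hk : 1 ≤ k := by omega
  have hr2 : 0 < r 2 := hr_first ▸ hr 1 (Finset.mem_Icc.2 ⟨le_rfl, by omega⟩)
  have hrpos : ∀ l, l + 1 ≤ k + 1 → 0 < r (l + 2) := fun l hl =>
    hr2.trans_le (radii_mono hr (by omega) (by omega) (by omega))
  have hrm : ∀ l, l + 2 ≤ k + 1 → r (l + 2) ≤ r (l + 3) := fun l hl =>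
    radii_mono hr (by omega) (by omega) (by omega)
  obtain ⟨K, E, hK, hE⟩ := exists_bessel_weight
  set D := (1 + 12 * K) ^ k with hD
  have hD0 : 0 < D := by positivity
  set c := ∏ l ∈ Finset.Icc 2 (k + 1), (Real.pi * r l / 2) with hc
  have hc0 : 0 < c := by
    refine Finset.prod_pos fun l hl => ?_
    have hl' := Finset.mem_Icc.1 hl
    have := hr2.trans_le (radii_mono hr (i := 2) (j := l) (by omega) hl'.1 (by omega))
    positivity
  -- The first summand serves the estimate of f, the second that of the matrix B; D is the growth
  -- over the k = N - 1 interfaces.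
  refine ⟨2 * D * (4 / σ₀) + 2 * K * D / (r 2 ^ 2 * c), by positivity, fun σ hσ => ?_⟩
  set δ := stepDeviation (k + 1) r σ₀ σ with hδ
  have hδ0 : 0 ≤ δ := stepDeviation_nonneg _ _ _ _
  have hratio : ∀ l, l + 2 ≤ k + 1 → |σ (l + 1) / σ (l + 2) - 1| ≤ 4 / σ₀ * δ ∧
      |σ (l + 1) / σ (l + 2) - 1| ≤ 3 := fun l hl => by
    have m₁ : l + 1 ∈ Finset.Icc 1 (k + 1) := Finset.mem_Icc.2 ⟨by omega, by omega⟩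
    have m₂ : l + 2 ∈ Finset.Icc 1 (k + 1) := Finset.mem_Icc.2 ⟨by omega, by omega⟩
    exact abs_ratio_sub_one_le hσ₀ (hσ _ m₁) (hσ _ m₂)
      (abs_sub_le_stepDeviation hr_first hr_last hr σ₀ σ m₁)
      (abs_sub_le_stepDeviation hr_first hr_last hr σ₀ σ m₂)
  have hη0 : 0 ≤ 4 / σ₀ * δ := by positivity
  refine ⟨fun m z => ((layerCoeff m r σ (1, 0) z k).1 - 1) * bc (besselJ m) z +
    (layerCoeff m r σ (1, 0) z k).2 * bc (besselY m) z, fun m => ?_, fun q hq z hz m => ?_⟩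
  · obtain ⟨c₁, c₂⟩ := continuousOn_layerCoeff (m := m) (σ := σ) (p₀ := (1, 0)) hrpos (le_refl (k + 1))
    exact ((c₁.sub continuousOn_const).mul (hbcJ m)).add (c₂.mul (hbcY m))
  obtain ⟨hEb, hEm, hEp⟩ := hE m
  have hlast : z * r (k + 2) = z := by rw [hr_last, mul_one]
  set X := max |bc (besselJ m) z| |bc (besselY m) z| with hX
  have hX1 : |bc (besselJ m) z| ≤ X := le_max_left _ _
  have hX2 : |bc (besselY m) z| ≤ X := le_max_right _ _
  have hX0 : 0 ≤ X := (abs_nonneg _).trans hX1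
  have hrest : 0 ≤ 2 * K * D / (r 2 ^ 2 * c) := by positivity
  have hrest' : 0 ≤ 2 * D * (4 / σ₀) := by positivity
  refine ⟨?_, ?_, ?_⟩
  · rw [prod_mul_det_transmissionMatrix hk bc hz (fun l hl => hrpos l (by omega)) (p₀ := (1, 0))
      (by ring) (by ring), show k + 1 + 1 = k + 2 by ring, hlast]
    ring
  · have hE2 := hEb (z * r 2) (by positivity)
    obtain ⟨-, b₁, b₂⟩ := layerCoeff_bounds (m := m) (p₀ := (1, 0)) (M := 1) hK hEb hEm hEp hz hrpos hrm
      (fun l hl => (hratio l hl).1) (fun l hl => (hratio l hl).2) (by simp)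
      (by simpa using hE2.1.le) hη0 (le_refl (k + 1))
    simp only [sub_zero, mul_one] at b₁ b₂
    refine (abs_add_le _ _).trans ?_
    rw [abs_mul, abs_mul]
    calc _ ≤ 4 / σ₀ * δ * D * X + 4 / σ₀ * δ * D * X := by gcongr
      _ = 2 * D * (4 / σ₀) * δ * X := by ring
      _ ≤ (2 * D * (4 / σ₀) + 2 * K * D / (r 2 ^ 2 * c)) * δ * X := by gcongr; linarith
  · have hz2 : 0 < z * r 2 := by positivity
    obtain ⟨e0, e1⟩ := hEb (z * r 2) hz2
    -- The lower bound on q only serves to control the factor 1/q that appears when J' is written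
    -- through the Euler derivative.
    have hq2 : r 2 ^ 2 ≤ q := by
      have := hq.1
      rw [hr_last, div_one] at this
      rwa [sq]
    have hq0 : 0 < q := lt_of_lt_of_le (by positivity) hq2
    have hzq : 0 < z * q := by positivity
    -- Starting from (0, 1), the condition |b| ≤ M E(z r_2) forces M = 1/E(z r_2).
    obtain ⟨⟨b₁, b₂⟩, -, -⟩ := layerCoeff_bounds (m := m) (p₀ := (0, 1)) (M := 1 / E m (z * r 2)) hK hEb
      hEm hEp hz hrpos hrm (fun l hl => (hratio l hl).1) (fun l hl => (hratio l hl).2)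
      (by simpa using e0.le) (by simp [e0.ne']) hη0 (le_refl (k + 1))
    have b₂' : |(layerCoeff m r σ (0, 1) z k).2| ≤ D * (1 / E m (z * r 2)) :=
      b₂.trans (mul_le_of_le_one_right (by positivity)
        (hEb _ (mul_pos hz (hrpos k le_rfl))).2)
    have hdet := prod_mul_det_transmissionMatrix (m := m) (σ := σ) (first := besselY m) hk bc hz
      (fun l hl => hrpos l (by omega)) (p₀ := (0, 1)) (by ring) (by ring)
    rw [hlast] at hdet
    have hP : ∏ l ∈ Finset.Icc 2 (k + 1), (Real.pi * z * r l / 2) = z ^ k * c := by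
      rw [hc, show z ^ k = ∏ _l ∈ Finset.Icc 2 (k + 1), z by simp, ← Finset.prod_mul_distrib]
      exact Finset.prod_congr rfl fun l _ => by ring
    rw [hP] at hdet
    set d := (transmissionMatrix m (k + 1) r σ (besselY m) bc z).det with hd
    -- Of the N powers of z, one turns J' into the Euler derivative and the other N - 1 normalise
    -- the determinant.
    have hid : z ^ (k + 1) * besselJ m (z * q) * deriv (besselJ m) (z * q) * d =
        (besselJ m (z * q) * ladderEuler besselJ m (z * q)) * (z ^ k * c * d) / (q * c) := by
      rw [deriv_besselJ_eq m hzq, pow_succ]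
      field_simp
    have hw : |besselJ m (z * q) * ladderEuler besselJ m (z * q)| ≤ K * E m (z * r 2) := by
      refine (hEp _ hzq).fst_fst.trans ?_
      have : E m (z * q) ≤ E m (z * r 2) := by
        refine hEm hzq hz2 ?_
        have := hq.2
        gcongr
      gcongr
    have hval : |z ^ k * c * d| ≤ 2 * D * (1 / E m (z * r 2)) * X := by
      rw [hdet]
      refine (abs_add_le _ _).trans ?_
      rw [abs_mul, abs_mul]
      calc _ ≤ D * (1 / E m (z * r 2)) * X + D * (1 / E m (z * r 2)) * X := by gcongr
        _ = _ := by ring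
    rw [hid, abs_div, abs_mul, abs_of_pos (by positivity : 0 < q * c)]
    calc |besselJ m (z * q) * ladderEuler besselJ m (z * q)| * |z ^ k * c * d| / (q * c)
        ≤ (K * E m (z * r 2)) * (2 * D * (1 / E m (z * r 2)) * X) / (r 2 ^ 2 * c) := by gcongr
      _ = 2 * K * D / (r 2 ^ 2 * c) * X := by field_simp
      _ ≤ (2 * D * (4 / σ₀) + 2 * K * D / (r 2 ^ 2 * c)) * X := by gcongr; linarith

lemma continuousOn_bessel (m : ℕ) :
    ContinuousOn (besselJ m) (Set.Ioi 0) ∧ ContinuousOn (besselY m) (Set.Ioi 0) ∧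
      ContinuousOn (deriv (besselJ m)) (Set.Ioi 0) ∧
      ContinuousOn (deriv (besselY m)) (Set.Ioi 0) := by
  have key : ∀ u v : ℝ → ℝ, IsBesselPair m u v →
      ContinuousOn u (Set.Ioi 0) ∧ ContinuousOn (deriv u) (Set.Ioi 0) := fun u v h => by
    refine ⟨fun x hx => (h.hasDerivAt_fst x hx).continuousAt.continuousWithinAt, ?_⟩
    have hv : ContinuousOn (fun x => v x / x) (Set.Ioi 0) :=
      ContinuousOn.div (fun x hx => (h.hasDerivAt_snd x hx).continuousAt.continuousWithinAt)
        continuousOn_id fun x hx => (Set.mem_Ioi.1 hx).ne'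
    exact hv.congr fun x hx => (h.hasDerivAt_fst x hx).deriv
  have hJ := key _ _ (isBesselLadder_besselJ.isBesselPair m)
  have hY := key _ _ (isBesselLadder_besselY.isBesselPair m)
  exact ⟨hJ.1, hY.1, hJ.2, hY.2⟩

end

end

/-! ### The Dirichlet and Neumann cases together -/

theorem lemma4p3 (N : ℕ) (hN : 2 ≤ N)
    (r : ℕ → ℝ) (hr_first : r 1 = 0) (hr_last : r (N + 1) = 1)
    (hr_lt : ∀ l ∈ Finset.Icc 1 N, r l < r (l + 1))
    (ε₀ μ₀ : ℝ) (hε₀ : 0 < ε₀) (hμ₀ : 0 < μ₀) :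
    ∃ C : ℝ, 0 < C ∧
      ∀ ε μ : ℕ → ℝ,
        (∀ l ∈ Finset.Icc 1 N, ε₀ / 2 ≤ ε l ∧ ε l ≤ 2 * ε₀) →
        (∀ l ∈ Finset.Icc 1 N, μ₀ / 2 ≤ μ l ∧ μ l ≤ 2 * μ₀) →
        ∃ fDir fNeu : ℕ → ℝ → ℝ,
          (∀ m : ℕ, ContinuousOn (fDir m) (Set.Ioi 0)) ∧
          (∀ m : ℕ, ContinuousOn (fNeu m) (Set.Ioi 0)) ∧
          ∀ q ∈ Set.Icc (r 2 / r (N + 1) * r 2) (r 2), ∀ z : ℝ, 0 < z → ∀ m : ℕ,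
            ((∏ l ∈ Finset.Icc 2 N, (Real.pi * z * r l / 2)) * (AmatDir m N r ε z).det
                = besselJ m (z * r (N + 1)) + fDir m z ∧
              |fDir m z| ≤ C * materialDeviation N r ε₀ μ₀ ε μ *
                max |besselJ m z| |besselY m z| ∧
              |z ^ N * besselJ m (z * q) * deriv (besselJ m) (z * q) * (BmatDir m N r ε z).det|
                ≤ C * max |besselJ m z| |besselY m z|) ∧
            ((∏ l ∈ Finset.Icc 2 N, (Real.pi * z * r l / 2)) * (AmatNeu m N r μ z).det
                = deriv (besselJ m) (z * r (N + 1)) + fNeu m z ∧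
              |fNeu m z| ≤ C * materialDeviation N r ε₀ μ₀ ε μ *
                max |deriv (besselJ m) z| |deriv (besselY m) z| ∧
              |z ^ N * besselJ m (z * q) * deriv (besselJ m) (z * q) * (BmatNeu m N r μ z).det|
                ≤ C * max |deriv (besselJ m) z| |deriv (besselY m) z|) := by
  obtain ⟨C₁, hC₁, H₁⟩ := transmission_estimate hN hr_first hr_last hr_lt hε₀ id
    (fun m => (continuousOn_bessel m).1) (fun m => (continuousOn_bessel m).2.1)
  obtain ⟨C₂, hC₂, H₂⟩ := transmission_estimate hN hr_first hr_last hr_lt hμ₀ deriv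
    (fun m => (continuousOn_bessel m).2.2.1) (fun m => (continuousOn_bessel m).2.2.2)
  refine ⟨C₁ + C₂, by positivity, fun ε μ hε hμ => ?_⟩
  obtain ⟨fDir, hfDir, h₁⟩ := H₁ ε hε
  obtain ⟨fNeu, hfNeu, h₂⟩ := H₂ μ hμ
  have hδε := stepDeviation_nonneg N r ε₀ ε
  have hδμ := stepDeviation_nonneg N r μ₀ μ
  refine ⟨fDir, fNeu, hfDir, hfNeu, fun q hq z hz m => ?_⟩
  obtain ⟨a₁, a₂, a₃⟩ := h₁ q hq z hz m
  obtain ⟨b₁, b₂, b₃⟩ := h₂ q hq z hz m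
  refine ⟨⟨a₁, a₂.trans ?_, a₃.trans ?_⟩, ⟨b₁, b₂.trans ?_, b₃.trans ?_⟩⟩
  · simp only [id, materialDeviation]
    gcongr <;> linarith
  · simp only [id]
    gcongr
    linarith
  · unfold materialDeviation
    gcongr <;> linarith
  · gcongr
    linarith
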